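/- \textbf{Setting.} For $\alpha=1,2$ let $H_\alpha\in\mathbb F_2^{r_\alpha\times n_\alpha}$, $n_\alpha=k_\alpha+r_\alpha$, be a full-rank check matrix of a classical $[n_\alpha,k_\alpha,d_\alpha]$ code, with bits ordered so that the last $r_\alpha$ columns are linearly independent; the first $k_\alpha$ bits are the information bits, and $b^\alpha_j\in\ker H_\alpha$ ($j\in[k_\alpha]$) is the codeword whose information part is the unit vector $e_j$. (If $H_\alpha=(h_1,\dots,h_{k_\alpha},I)$, then $b^\alpha_j=(e_j,h_j)$.) The hypergraph product code $\mathcal Q=\mathrm{HGP}(H_1,H_2)$ is the CSS code with check matrices $$H_X=(I_{n_1}\otimes H_2,\;H_1^T\otimes I_{r_2}),\qquad H_Z=(H_1\otimes I_{n_2},\;I_{r_1}\otimes H_2^T),$$ and the same formulas define $\mathrm{HGP}$ of any two check matrices. The logical qubits of $\mathcal Q$ form a $k_1\times k_2$ grid, in which $\bar Z_{i,j}$ is the $Z$-type operator with vector $(e_i\otimes b^2_j,\,0)$. Let $\mathcal E_h$ be a set of nonempty, pairwise disjoint subsets (hyperedges) of $[k_2]$, and put $d=\min\{d_1,d_2\}$.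 \textbf{Gadget.} Let $S=[k_2]\setminus\bigcup_{e\in\mathcal E_h}e$. Let $H_2'$ be obtained from $H_2$ by appending, for each $e\in\mathcal E_h$, the $|e|-1$ parity checks of consecutive elements of $e$, and then deleting the columns in $S$. The ancilla code is $\mathcal Q'=\mathrm{HGP}(H_1,H_2')$. Its qubits are those of $\mathcal Q$ with the coordinates $[n_1]\times S$ removed, and one extra qubit for each pair (check of $H_1$, appended check). The gadget (i) prepares all qubits of $\mathcal Q'$ in $|0\rangle$ and measures all the checks of $\mathcal Q'$ for $d$ rounds; (ii) applies a CNOT from each qubit of $\mathcal Q$ outside $[n_1]\times S$ to the qubit of $\mathcal Q'$ with the same coordinates; (iii) measures every qubit of $\mathcal Q'$ in the $Z$ basis. \textbf{Theorem.} \begin{enumerate} \item $\mathcal Q'$ is a CSS code with exactly $k_1|\mathcal E_h|$ logical qubits, and its distance (the least weight of a nontrivial logical Pauli operator; $\infty$ if there is none) is at least $d$. \item \emph{Parallel measurement.} One run of the gadget without faults implements, on every input state (density operator) of the code space of $\mathcal Q$, exactly the joint nondestructive projective measurement of the $k_1|\mathcal E_h|$ logical Pauli products $$\bigcup_{i\in[k_1]}\Big\{\bigotimes_{j\in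 e}\bar Z_{i,j}\Big\}_{e\in\mathcal E_h}.$$ The outcome for $(i,e)$ is the parity of the readout in (iii) over the ancilla qubits with the coordinates of the support of $\bigotimes_{j\in e}\bar Z_{i,j}$. The output state is that of the ideal measurement after a Pauli correction (Pauli frame update) of the data qubits which depends only on the outcomes observed in the run. \item \emph{Fault tolerance.} Consider fault patterns in which each of the following counts as one fault: a Pauli error on one data or ancilla qubit before one of the $d$ rounds or between the last round and the CNOTs; a flipped outcome of one check in one round; after the CNOT layer, a Pauli error on one CNOT pair (an arbitrary two-qubit Pauli) or on one qubit not in a CNOT; a flipped readout of one ancilla qubit. There are a decoder computing the $k_1|\mathcal E_h|$ measurement outcomes from the outcomes observed in the run, and a decoder computing a Pauli correction of the data qubits from these and from the outcomes of a subsequent ideal measurement of the checks of $\mathcal Q$, such that, for every fault pattern with fewer than $d/2$ faults, the run followed by the correction implements exactly the ideal measurement of 2 on every input state of the code space of $\mathcal Q$. \end{enumerate} -/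

import Mathlib

open scoped Matrix Kronecker

noncomputable section

namespace HGPGadget

/-! ### Qubits, states, Pauli operators -/

/-- Computational-basis labels of a register whose qubits are labelled by `ι`. -/
abbrev Bits (ι : Type*) := ι → ZMod 2

/-- Linear operators from the state space of register `κ` to the state space of register `ι`,
written as matrices in the computational basis. -/
abbrev Op (ι κ : Type*) := Matrix (Bits ι) (Bits κ) ℂ

/-- The sign `(-1)^a`. -/
def sgn (a : ZMod 2) : ℂ := if a = 0 then 1 else -1

/-- A Pauli operator `X^x Z^z` (up to a global phase). -/
structure Pauli (ι : Type*) where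
  x : ι → ZMod 2
  z : ι → ZMod 2

/-- The operator `X^x Z^z`, sending `|v⟩` to `(-1)^{z·v} |v + x⟩`. -/
def Pauli.op {ι : Type*} [Fintype ι] [DecidableEq ι] (P : Pauli ι) : Op ι ι :=
  Matrix.of fun u v => if u = v + P.x then sgn (P.z ⬝ᵥ v) else 0

/-- The qubits on which a Pauli operator is not the identity. -/
def Pauli.support {ι : Type*} [Fintype ι] (P : Pauli ι) : Finset ι :=
  Finset.univ.filter fun q => P.x q ≠ 0 ∨ P.z q ≠ 0

/-- The weight of a Pauli operator. -/
def Pauli.weight {ι : Type*} [Fintype ι] (P : Pauli ι) : ℕ := P.support.card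

/-- The projector of a joint measurement of the `Z`-type operators `Z^h`, `h` a row of `H`, with
outcomes `(-1)^{s}`: the rows of `H` must have parities `s` on the basis label. -/
def zProj {κ ι : Type*} [Fintype κ] [Fintype ι] [DecidableEq ι] [DecidableEq κ]
    (H : Matrix κ ι (ZMod 2)) (s : κ → ZMod 2) : Op ι ι :=
  Matrix.diagonal fun v => if H *ᵥ v = s then 1 else 0

/-- The projector of a joint measurement of the `X`-type operators `X^h`, `h` a row of `H`, with
outcomes `(-1)^{s}`: the product over the rows of `(1 + (-1)^{s_c} X^{H_c}) / 2`, expanded. -/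
def xProj {κ ι : Type*} [Fintype κ] [Fintype ι] [DecidableEq ι] [DecidableEq κ]
    (H : Matrix κ ι (ZMod 2)) (s : κ → ZMod 2) : Op ι ι :=
  ((2 : ℂ) ^ Fintype.card κ)⁻¹ •
    ∑ a : κ → ZMod 2, sgn (a ⬝ᵥ s) • (Pauli.mk (a ᵥ* H) 0).op

/-! ### CSS codes -/

/-- A CSS code on qubits `Q`, with `X`-checks `SX` and `Z`-checks `SZ`. -/
structure CSS (Q SX SZ : Type*) [Fintype Q] where
  HX : Matrix SX Q (ZMod 2)
  HZ : Matrix SZ Q (ZMod 2)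
  comm : HX * HZᵀ = 0

/-- Outcomes of one measurement of all the `X`- and `Z`-checks. -/
abbrev Syndrome (SX SZ : Type*) := (SX → ZMod 2) × (SZ → ZMod 2)

namespace CSS

variable {Q SX SZ : Type*} [Fintype Q]

/-- Commutes with all the stabilizers. -/
def IsNormalizer (C : CSS Q SX SZ) (P : Pauli Q) : Prop :=
  C.HZ *ᵥ P.x = 0 ∧ C.HX *ᵥ P.z = 0

/-- Is a stabilizer (up to phase). -/
def IsStabilizer (C : CSS Q SX SZ) (P : Pauli Q) : Prop :=
  P.x ∈ Submodule.span (ZMod 2) (Set.range C.HX.row) ∧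
    P.z ∈ Submodule.span (ZMod 2) (Set.range C.HZ.row)

/-- The distance: the least weight of a nontrivial logical operator, and `⊤` for a code without
nontrivial logical operators. -/
def distance (C : CSS Q SX SZ) : ℕ∞ :=
  ⨅ P : {P : Pauli Q // C.IsNormalizer P ∧ ¬ C.IsStabilizer P}, (P.1.weight : ℕ∞)

/-- The projector of a measurement of all the checks with outcomes `s`. -/
def synProj [DecidableEq Q] [Fintype SX] [Fintype SZ] [DecidableEq SX] [DecidableEq SZ]
    (C : CSS Q SX SZ) (s : Syndrome SX SZ) : Op Q Q :=
  xProj C.HX s.1 * zProj C.HZ s.2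

/-- The projector on the code space. -/
def codeProj [DecidableEq Q] [Fintype SX] [Fintype SZ] [DecidableEq SX] [DecidableEq SZ]
    (C : CSS Q SX SZ) : Op Q Q := C.synProj 0

end CSS

/-- The checks of a code on register `A`, as checks on the joint register `D ⊕ A`. -/
def CSS.onAncilla {A SX SZ : Type*} [Fintype A] (C : CSS A SX SZ) (D : Type*) [Fintype D] :
    CSS (D ⊕ A) SX SZ where
  HX := Matrix.fromCols 0 C.HX
  HZ := Matrix.fromCols 0 C.HZ
  comm := by
    rw [Matrix.transpose_fromCols, Matrix.fromCols_mul_fromRows, C.comm]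
    simp

/-- The hypergraph product code of a vertical check matrix `H1` and a horizontal one `H2`; its
qubits are `B1 × B2 ∪ C1 × C2`. -/
def HGP {B1 C1 B2 C2 : Type*} [Fintype B1] [Fintype C1] [Fintype B2] [Fintype C2]
    [DecidableEq B1] [DecidableEq C1] [DecidableEq B2] [DecidableEq C2]
    (H1 : Matrix C1 B1 (ZMod 2)) (H2 : Matrix C2 B2 (ZMod 2)) :
    CSS ((B1 × B2) ⊕ (C1 × C2)) (B1 × C2) (C1 × B2) where
  HX := Matrix.fromCols ((1 : Matrix B1 B1 (ZMod 2)) ⊗ₖ H2) (H1ᵀ ⊗ₖ (1 : Matrix C2 C2 (ZMod 2)))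
  HZ := Matrix.fromCols (H1 ⊗ₖ (1 : Matrix B2 B2 (ZMod 2))) ((1 : Matrix C1 C1 (ZMod 2)) ⊗ₖ H2ᵀ)
  comm := by
    rw [Matrix.transpose_fromCols, Matrix.fromCols_mul_fromRows,
      ← Matrix.kroneckerMap_transpose, ← Matrix.kroneckerMap_transpose,
      ← Matrix.mul_kronecker_mul, ← Matrix.mul_kronecker_mul]
    simp only [Matrix.transpose_one, Matrix.transpose_transpose, Matrix.one_mul, Matrix.mul_one]
    ext i j
    exact CharTwo.add_self_eq_zero _

/-! ### Classical codes -/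

/-- `d` is the minimum distance of the code with check matrix `H` (so the code is nonzero). -/
def IsMinDist {C B : Type*} [Fintype B] (H : Matrix C B (ZMod 2)) (d : ℕ) : Prop :=
  IsLeast {w | ∃ c : B → ZMod 2, c ≠ 0 ∧ H *ᵥ c = 0 ∧ hammingNorm c = w} d

/-- Append the checks `H0` to `H`. -/
def augment {C C' B : Type*} (H : Matrix C B (ZMod 2)) (H0 : Matrix C' B (ZMod 2)) :
    Matrix (C ⊕ C') B (ZMod 2) := Matrix.fromRows H H0

/-- Delete the columns of `H` in `S`. -/
def puncture {C B : Type*} (H : Matrix C B (ZMod 2)) (S : Finset B) :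
    Matrix C {b // b ∉ S} (ZMod 2) := H.submatrix id Subtype.val

/-- The codeword `b_j` of `H` (whose last `r` columns are assumed invertible) which is the unit
vector `e_j` on the `k` information bits. For `H = (h_1, …, h_k, I)` it is `(e_j, h_j)`. -/
def canonicalWord {k r : ℕ} (H : Matrix (Fin r) (Fin k ⊕ Fin r) (ZMod 2)) (j : Fin k) :
    Fin k ⊕ Fin r → ZMod 2 :=
  Sum.elim (Pi.single j 1) (H.toCols₂⁻¹ *ᵥ fun c => H c (Sum.inl j))

/-- The `Z`-type vector of the canonical logical operator `Z̄_{i,j}`: `e_i ⊗ b_j` on the qubits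
`B1 × B2`, and `0` on `C1 × C2`. -/
def logicalZ {k1 r1 k2 r2 : ℕ} (H2 : Matrix (Fin r2) (Fin k2 ⊕ Fin r2) (ZMod 2))
    (i : Fin k1) (j : Fin k2) :
    ((Fin k1 ⊕ Fin r1) × (Fin k2 ⊕ Fin r2)) ⊕ (Fin r1 × Fin r2) → ZMod 2 :=
  Sum.elim
    (fun q => (Pi.single (Sum.inl i) 1 : Fin k1 ⊕ Fin r1 → ZMod 2) q.1 * canonicalWord H2 j q.2)
    0

/-! ### The ancilla code of the horizontal Pauli product measurement gadget -/

/-- The information bits in none of the hyperedges. -/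
def puncturedBits {k2 : ℕ} (r2 : ℕ) (E : Finset (Finset (Fin k2))) :
    Finset (Fin k2 ⊕ Fin r2) :=
  (Finset.univ \ E.biUnion id).map Function.Embedding.inl

/-- Labels of the repetition checks: `|e| - 1` for each hyperedge `e`. -/
abbrev RepCheck {k2 : ℕ} (E : Finset (Finset (Fin k2))) := Σ e : E, Fin (e.1.card - 1)

/-- The repetition checks: parities of consecutive bits of each hyperedge. -/
def repMatrix {k2 : ℕ} (r2 : ℕ) (E : Finset (Finset (Fin k2))) :
    Matrix (RepCheck E) (Fin k2 ⊕ Fin r2) (ZMod 2) :=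
  Matrix.of fun c =>
    Pi.single (Sum.inl (c.1.1.orderEmbOfFin rfl ⟨c.2.1, by have := c.2.2; omega⟩)) 1 +
    Pi.single (Sum.inl (c.1.1.orderEmbOfFin rfl ⟨c.2.1 + 1, by have := c.2.2; omega⟩)) 1

/-- The horizontal check matrix of the ancilla code: augment, then puncture. -/
def ancillaH2 {k2 r2 : ℕ} (H2 : Matrix (Fin r2) (Fin k2 ⊕ Fin r2) (ZMod 2))
    (E : Finset (Finset (Fin k2))) :
    Matrix (Fin r2 ⊕ RepCheck E) {b : Fin k2 ⊕ Fin r2 // b ∉ puncturedBits r2 E} (ZMod 2) :=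
  puncture (augment H2 (repMatrix r2 E)) (puncturedBits r2 E)

/-- The data qubit with the same coordinates as a given ancilla qubit. The ancilla qubits of the
repetition checks have no partner. -/
def partner {k1 r1 k2 r2 : ℕ} (E : Finset (Finset (Fin k2))) :
    ((Fin k1 ⊕ Fin r1) × {b : Fin k2 ⊕ Fin r2 // b ∉ puncturedBits r2 E}) ⊕
      (Fin r1 × (Fin r2 ⊕ RepCheck E)) →
    Option (((Fin k1 ⊕ Fin r1) × (Fin k2 ⊕ Fin r2)) ⊕ (Fin r1 × Fin r2))
  | Sum.inl (b1, b2) => some (Sum.inl (b1, b2.1))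
  | Sum.inr (c1, Sum.inl c2) => some (Sum.inr (c1, c2))
  | Sum.inr (_, Sum.inr _) => none

/-- The Pauli products to be measured: row `(i, e)` is the vector of `∏_{j ∈ e} Z̄_{i,j}`. -/
def ppm {k1 k2 r2 : ℕ} (r1 : ℕ) (H2 : Matrix (Fin r2) (Fin k2 ⊕ Fin r2) (ZMod 2))
    (E : Finset (Finset (Fin k2))) :
    Matrix (Fin k1 × E) (((Fin k1 ⊕ Fin r1) × (Fin k2 ⊕ Fin r2)) ⊕ (Fin r1 × Fin r2)) (ZMod 2) :=
  Matrix.of fun p => ∑ j ∈ p.2.1, logicalZ H2 p.1 j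

/-! ### Steane-type measurement of a data code through an ancilla code

`D` and `A` are the data and the ancilla qubits, and `pt : A → Option D` tells which data qubit, if
any, is paired with an ancilla qubit. -/

section Circuit

variable {D A : Type*} [Fintype D] [Fintype A] [DecidableEq D] [DecidableEq A]
variable {SX SZ TX TZ : Type*} [Fintype SX] [Fintype SZ] [DecidableEq SX] [DecidableEq SZ]
variable [Fintype TX] [Fintype TZ] [DecidableEq TX] [DecidableEq TZ]

/-- Append the ancilla register in the state `|0…0⟩`. -/
def prepOp (D A : Type*) [Fintype A] [Fintype D] [DecidableEq A] [DecidableEq D] : Op (D ⊕ A) D :=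
  Matrix.of fun u v => if u = Sum.elim v 0 then 1 else 0

/-- Apply `⟨m|` to the ancilla register. -/
def readOp (D : Type*) {A : Type*} [Fintype A] [Fintype D] [DecidableEq A] [DecidableEq D]
    (m : A → ZMod 2) : Op D (D ⊕ A) :=
  Matrix.of fun u v => if v = Sum.elim u m then 1 else 0

/-- A CNOT from each paired data qubit (control) to its ancilla qubit (target). -/
def cnotOp (pt : A → Option D) : Op (D ⊕ A) (D ⊕ A) :=
  Matrix.of fun u v =>
    if u = Sum.elim (fun q => v (Sum.inl q))
        (fun a => v (Sum.inr a) + (pt a).elim 0 (fun q => v (Sum.inl q)))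
    then 1 else 0

/-- All the outcomes of a run: the ancilla syndromes of `d` rounds and the final `Z`-basis readout
of the ancilla qubits. -/
abbrev Record (A TX TZ : Type*) (d : ℕ) := (Fin d → Syndrome TX TZ) × (A → ZMod 2)

/-- A pattern of faults in a run: Pauli errors on the data and ancilla qubits before each round of
checks and between the last round and the CNOTs, flipped check outcomes in each round, Pauli errors
after the CNOTs, and flipped readout outcomes. -/
structure Faults (D A TX TZ : Type*) (d : ℕ) where
  idle : Fin (d + 1) → Pauli (D ⊕ A)
  flip : Fin d → Syndrome TX TZ
  cnot : Pauli (D ⊕ A)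
  readout : A → ZMod 2

/-- No faults. -/
def noFaults (D A TX TZ : Type*) (d : ℕ) : Faults D A TX TZ d where
  idle _ := ⟨0, 0⟩
  flip _ := 0
  cnot := ⟨0, 0⟩
  readout := 0

/-- The location, in the layer of CNOTs, of a qubit: a paired ancilla qubit shares the location of
its data partner (a two-qubit gate), and any other qubit is a location by itself. -/
def cnotLocation (pt : A → Option D) : D ⊕ A → D ⊕ A
  | Sum.inl q => Sum.inl q
  | Sum.inr a => (pt a).elim (Sum.inr a) Sum.inl

/-- The number of faulty locations. An arbitrary two-qubit Pauli error after one CNOT is one fault. -/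
def Faults.weight (pt : A → Option D) {d : ℕ} (F : Faults D A TX TZ d) : ℕ :=
  (∑ t, (F.idle t).weight) + (∑ t, (hammingNorm (F.flip t).1 + hammingNorm (F.flip t).2)) +
    (F.cnot.support.image (cnotLocation pt)).card + hammingNorm F.readout

/-- The Kraus operator of a run with faults `F` and with observed outcomes `r`: prepare `|0…0⟩`,
measure the checks of the ancilla code `C'` in `d` rounds, apply the CNOTs, read out the ancilla. -/
def kraus (C' : CSS A TX TZ) (pt : A → Option D) {d : ℕ} (F : Faults D A TX TZ d)
    (r : Record A TX TZ d) : Op D D :=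
  readOp D (r.2 + F.readout) * F.cnot.op * cnotOp pt * (F.idle (Fin.last d)).op *
    Fin.foldl (α := Op (D ⊕ A) D) d
      (fun (M : Op (D ⊕ A) D) t => (C'.onAncilla D).synProj (r.1 t + F.flip t) * ((F.idle t.castSucc).op * M))
      (prepOp D A)

/-- Without faults, the gadget performs the ideal nondestructive measurement of the `Z`-type
operators given by the rows of `M` on the code space of `C`, in one run: the outcomes are the
parities of the ancilla readout on the qubits paired with the support of the rows, and after a Pauli
frame correction that depends on the record only, the collection of unnormalized output states, for
all outcomes `μ`, is that of the ideal projective measurement. -/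
def Performs (C : CSS D SX SZ) (C' : CSS A TX TZ) (pt : A → Option D) (d : ℕ)
    {κ : Type*} [DecidableEq κ] [Fintype κ] (M : Matrix κ D (ZMod 2)) : Prop :=
  ∃ frame : Record A TX TZ d → Pauli D,
    ∀ ρ : Op D D, C.codeProj * ρ * C.codeProj = ρ → ∀ μ : κ → ZMod 2,
      ∑ r : Record A TX TZ d with
          (∀ c, ∑ a, (pt a).elim 0 (fun q => M c q) * r.2 a = μ c),
        ((frame r).op * kraus C' pt (noFaults D A TX TZ d) r) * ρ *
          ((frame r).op * kraus C' pt (noFaults D A TX TZ d) r)ᴴ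
        = zProj M μ * ρ * zProj M μ

/-- The gadget tolerates every pattern of `f` faults with `2 f < δ`: there are a decoder `out` for
the measured outcomes, which sees the record of the run, and a decoder `recover`, which sees also
the outcomes `τ` of a subsequent ideal measurement of the checks of the data code, such that for
each such pattern, run and recovery together are exactly the ideal measurement of `M`. -/
def ToleratesFaults (C : CSS D SX SZ) (C' : CSS A TX TZ) (pt : A → Option D) (d : ℕ)
    {κ : Type*} [DecidableEq κ] [Fintype κ] (M : Matrix κ D (ZMod 2)) (δ : ℕ) : Prop :=
  ∃ (out : Record A TX TZ d → κ → ZMod 2)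
    (recover : Record A TX TZ d → Syndrome SX SZ → Pauli D),
    ∀ F : Faults D A TX TZ d, 2 * F.weight pt < δ →
    ∀ ρ : Op D D, C.codeProj * ρ * C.codeProj = ρ → ∀ μ : κ → ZMod 2,
      ∑ r : Record A TX TZ d with out r = μ, ∑ τ : Syndrome SX SZ,
        ((recover r τ).op * C.synProj τ * kraus C' pt F r) * ρ *
          ((recover r τ).op * C.synProj τ * kraus C' pt F r)ᴴ
        = zProj M μ * ρ * zProj M μ

end Circuit

end HGPGadget

end

open scoped Matrix Kronecker

set_option linter.unusedSectionVars false

noncomputable section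

namespace HGPGadget

/-! ### Signs and vectors over `ZMod 2` -/

/-! All operators are tracked up to a sign, which is harmless because only `K * ρ * Kᴴ` matters
(`PhaseEq.conj`). Every error is pushed to the left end of the circuit: past a check projector it
shifts the outcome by its syndrome, past the CNOTs it spreads linearly, and past the readout it
becomes a shift of the readout and a Pauli on the data. By `kraus_of_consistent`, a run is then a
residual Pauli times a scalar times the diagonal indicator that readout, readout error and copied
data label add up to a combination of the `X`-checks of the ancilla code. The random `X`-syndrome
enters only as a `Z`-type frame.

On the code space the copied label satisfies the `Z`-checks of the ancilla code. There, being a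
combination of `X`-checks amounts to satisfying the `Z`-checks and having trivial measured parities
(`exact_at` of `IsSteaneGadget`). The indicator thus becomes the projector for the outcome read off
the ancilla (`diagonal_mul_codeProj`), and counting the records of each outcome cancels the scalars
(`sum_record`).

For fault tolerance the decoders pick any pattern of fewer than `d / 2` faults that explains the
record; it must be shown equivalent to the true one. Readout errors and `X`-residuals of the two
patterns differ by vectors of weight below `d` with trivial syndrome, hence by stabilizers. For
`Z`-residuals, some round has no flipped `X`-check in either pattern. Errors before that round agree
up to an ancilla `Z`-operator commuting with the `X`-checks, which acts on the data as stabilizers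
and measured operators (`exists_vecMul_of_HX_mulVec_eq_zero`); errors after it have low weight.
Measured operators act by a sign after the measurement, so nothing is lost (`resid_add_resid`,
`stabilizer_op_mul`).

For hypergraph products, a vector satisfying the `Z`-checks is a pair of matrices with `H1 * X + Y *
H2 = 0`. It comes from the `X`-checks as soon as `X` kills `ker H2` (`exists_factor`). Since `X`
maps `ker H2` into `ker H1`, this holds if `X` has fewer nonzero entries than the distance of `H1`.
For the ancilla code it also holds if the measured parities vanish: they are the information bits of
the images of the words `edgeWord H2 e`, which span the kernel. -/

lemma vec_add_self {ι : Type*} (x : ι → ZMod 2) : x + x = 0 := by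
  ext i; exact CharTwo.add_self_eq_zero _

lemma vec_eq_add_iff {ι : Type*} {x y z : ι → ZMod 2} : x = y + z ↔ x + z = y := by
  constructor
  · rintro rfl; rw [add_assoc, vec_add_self, add_zero]
  · rintro rfl; rw [add_assoc, vec_add_self, add_zero]

lemma vec_add_eq_zero {ι : Type*} {x y : ι → ZMod 2} : x + y = 0 ↔ x = y := by
  rw [← vec_eq_add_iff, zero_add]

@[simp] lemma sgn_zero : sgn 0 = 1 := by simp [sgn]

@[simp] lemma sgn_one : sgn 1 = -1 := by simp [sgn]

lemma sgn_add (a b : ZMod 2) : sgn (a + b) = sgn a * sgn b := by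
  have h2 : ∀ t : ZMod 2, t = 0 ∨ t = 1 := by decide
  rcases h2 a with rfl | rfl <;> rcases h2 b with rfl | rfl <;>
    simp [CharTwo.add_self_eq_zero]

lemma sgn_mul_self (a : ZMod 2) : sgn a * sgn a = 1 := by
  rw [← sgn_add, CharTwo.add_self_eq_zero, sgn_zero]

lemma star_sgn (a : ZMod 2) : star (sgn a) = sgn a := by
  unfold sgn; split_ifs <;> simp

lemma sum_sgn {κ : Type*} [Fintype κ] [DecidableEq κ] (s : κ → ZMod 2) :
    ∑ a : κ → ZMod 2, sgn (a ⬝ᵥ s) = if s = 0 then (2 : ℂ) ^ Fintype.card κ else 0 := by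
  split_ifs with h
  · subst h; simp
  · obtain ⟨c, hc⟩ := Function.ne_iff.1 h
    have hc1 : s c = 1 := by
      have : ∀ t : ZMod 2, t ≠ 0 → t = 1 := by decide
      exact this _ hc
    -- Translating the summation variable by a unit vector at a coordinate where `s` is 1 flips
    -- every sign.
    have key : ∑ a : κ → ZMod 2, sgn (a ⬝ᵥ s) = -∑ a : κ → ZMod 2, sgn (a ⬝ᵥ s) := by
      rw [← Finset.sum_neg_distrib]
      refine Fintype.sum_equiv (Equiv.addRight (Pi.single c 1)) _ _ fun a => ?_
      simp [add_dotProduct, sgn_add, hc1]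
    linear_combination (1 / 2 : ℂ) * key

/-! ### Equality of operators up to a sign -/

/-- Equality up to a sign. -/
def PhaseEq {m n : Type*} (A B : Matrix m n ℂ) : Prop := ∃ a : ZMod 2, A = sgn a • B

namespace PhaseEq

variable {l m n : Type*} {A B C : Matrix m n ℂ}

lemma refl (A : Matrix m n ℂ) : PhaseEq A A := ⟨0, by simp⟩

lemma of_eq (h : A = B) : PhaseEq A B := h ▸ refl A

lemma of_sgn_smul (a : ZMod 2) (A : Matrix m n ℂ) : PhaseEq (sgn a • A) A := ⟨a, rfl⟩

lemma trans (h : PhaseEq A B) (h' : PhaseEq B C) : PhaseEq A C := by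
  obtain ⟨a, rfl⟩ := h
  obtain ⟨b, rfl⟩ := h'
  exact ⟨a + b, by rw [sgn_add, smul_smul]⟩

lemma smul (c : ℂ) (h : PhaseEq A B) : PhaseEq (c • A) (c • B) := by
  obtain ⟨a, rfl⟩ := h
  exact ⟨a, smul_comm _ _ _⟩

lemma mul_left [Fintype m] (M : Matrix l m ℂ) (h : PhaseEq A B) : PhaseEq (M * A) (M * B) := by
  obtain ⟨a, rfl⟩ := h
  exact ⟨a, by simp⟩

lemma mul_right [Fintype n] (M : Matrix n l ℂ) (h : PhaseEq A B) : PhaseEq (A * M) (B * M) := by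
  obtain ⟨a, rfl⟩ := h
  exact ⟨a, by simp⟩

lemma eq_zero (h : PhaseEq A 0) : A = 0 := by
  obtain ⟨a, rfl⟩ := h
  simp

/-- The sign occurs twice and squares to one. This is what permits computing with Kraus operators
modulo signs. -/
lemma conj [Fintype n] (h : PhaseEq A B) (ρ : Matrix n n ℂ) : A * ρ * Aᴴ = B * ρ * Bᴴ := by
  obtain ⟨a, rfl⟩ := h
  rw [Matrix.conjTranspose_smul, star_sgn, Matrix.mul_smul, Matrix.smul_mul, Matrix.smul_mul,
    smul_smul, sgn_mul_self, one_smul]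

end PhaseEq

/-! ### Pauli operators and syndrome projectors -/

section

variable {ι κ : Type*} [Fintype ι] [DecidableEq ι] [Fintype κ] [DecidableEq κ]

lemma Pauli.op_mul (P Q : Pauli ι) :
    P.op * Q.op = sgn (P.z ⬝ᵥ Q.x) • (Pauli.mk (P.x + Q.x) (P.z + Q.z)).op := by
  ext u w
  rw [Matrix.mul_apply, Finset.sum_eq_single (w + Q.x)]
  · by_cases h : u = w + Q.x + P.x
    · have h' : u = w + (P.x + Q.x) := by rw [h]; abel
      simp [Pauli.op, ← h, ← h', dotProduct_add, add_dotProduct, sgn_add]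
      ring
    · have h' : ¬ u = w + (P.x + Q.x) := by
        rintro rfl; exact h (by abel)
      simp [Pauli.op, h, h']
  · intro v _ hv
    simp [Pauli.op, hv]
  · simp

lemma Pauli.op_mul_phaseEq (P Q : Pauli ι) :
    PhaseEq (P.op * Q.op) (Pauli.mk (P.x + Q.x) (P.z + Q.z)).op := by
  rw [Pauli.op_mul]
  exact .of_sgn_smul _ _

lemma Pauli.op_zero : (Pauli.mk (0 : ι → ZMod 2) 0).op = 1 := by
  ext u v
  simp [Pauli.op, Matrix.one_apply]

lemma Pauli.op_x_zero (z : ι → ZMod 2) :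
    (Pauli.mk 0 z).op = Matrix.diagonal fun v => sgn (z ⬝ᵥ v) := by
  ext u v
  by_cases h : u = v
  · subst h; simp [Pauli.op]
  · simp [Pauli.op, h]

lemma Pauli.conjTranspose_op_z_zero (x : ι → ZMod 2) :
    (Pauli.mk x 0).opᴴ = (Pauli.mk x 0).op := by
  ext u v
  simp only [Pauli.op, Matrix.conjTranspose_apply, Matrix.of_apply, zero_dotProduct, sgn_zero]
  rw [apply_ite star, star_one, star_zero]
  exact if_congr (by rw [vec_eq_add_iff, eq_comm]) rfl rfl

/-- An `X`-error translates basis labels, hence shifts all parities by its syndrome; its `Z`-part is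
diagonal and does not interfere. -/
lemma zProj_mul_op (H : Matrix κ ι (ZMod 2)) (s : κ → ZMod 2) (P : Pauli ι) :
    zProj H s * P.op = P.op * zProj H (s + H *ᵥ P.x) := by
  ext u v
  rw [zProj, zProj, Matrix.diagonal_mul, Matrix.mul_diagonal, mul_comm]
  by_cases h : u = v + P.x
  · congr 1
    refine if_congr ?_ rfl rfl
    rw [h, Matrix.mulVec_add, vec_eq_add_iff]
  · simp [Pauli.op, h]

lemma xProj_mul_op (H : Matrix κ ι (ZMod 2)) (s : κ → ZMod 2) (P : Pauli ι) :
    xProj H s * P.op = P.op * xProj H (s + H *ᵥ P.z) := by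
  rw [xProj, xProj, Matrix.smul_mul, Matrix.mul_smul, Matrix.sum_mul, Matrix.mul_sum]
  congr 1
  refine Finset.sum_congr rfl fun a _ => ?_
  rw [Matrix.smul_mul, Matrix.mul_smul, Pauli.op_mul, Pauli.op_mul, smul_smul, smul_smul]
  simp only [zero_dotProduct, sgn_zero, mul_one, zero_add, add_zero]
  rw [add_comm P.x, dotProduct_add, sgn_add, Matrix.dotProduct_mulVec,
    dotProduct_comm P.z, mul_assoc, sgn_mul_self, mul_one]

/-- Multiplying by a product of rows only reindexes the expanded sum, so these products act by
scalars on the eigenspace. -/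
lemma op_row_mul_xProj (H : Matrix κ ι (ZMod 2)) (s b : κ → ZMod 2) :
    (Pauli.mk (b ᵥ* H) 0).op * xProj H s = sgn (b ⬝ᵥ s) • xProj H s := by
  rw [xProj, Matrix.mul_smul, smul_comm, Matrix.mul_sum]
  congr 1
  rw [Finset.smul_sum]
  refine Fintype.sum_equiv (Equiv.addRight b) _ _ fun a => ?_
  rw [Matrix.mul_smul, Pauli.op_mul]
  simp only [Equiv.coe_addRight, zero_dotProduct, sgn_zero, one_smul, smul_smul, add_dotProduct,
    sgn_add, Matrix.add_vecMul, add_zero]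
  rw [mul_comm (sgn (a ⬝ᵥ s)), ← mul_assoc, sgn_mul_self, one_mul, add_comm]

lemma zProj_mul_zProj (H : Matrix κ ι (ZMod 2)) (s t : κ → ZMod 2) :
    zProj H s * zProj H t = if s = t then zProj H s else 0 := by
  rw [zProj, zProj, Matrix.diagonal_mul_diagonal]
  split_ifs with h
  · subst h; congr 1; ext v; split_ifs <;> simp
  · rw [← Matrix.diagonal_zero]; congr 1; ext v
    split_ifs with h1 h2
    · exact absurd (h1.symm.trans h2) h
    all_goals simp

/-- Each term of the first factor acts on the second as a sign, and orthogonality of characters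
evaluates the sum. -/
lemma xProj_mul_xProj (H : Matrix κ ι (ZMod 2)) (s t : κ → ZMod 2) :
    xProj H s * xProj H t = if s = t then xProj H s else 0 := by
  conv_lhs => rw [xProj, Matrix.smul_mul, Matrix.sum_mul]
  have : ∀ a : κ → ZMod 2, sgn (a ⬝ᵥ s) • (Pauli.mk (a ᵥ* H) 0).op * xProj H t =
      sgn (a ⬝ᵥ (s + t)) • xProj H t := fun a => by
    rw [Matrix.smul_mul, op_row_mul_xProj, smul_smul, dotProduct_add, sgn_add]
  rw [Finset.sum_congr rfl fun a _ => this a, ← Finset.sum_smul, sum_sgn, smul_smul]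
  by_cases h : s = t
  · subst h
    simp [vec_add_self]
  · rw [if_neg (fun h' => h (vec_add_eq_zero.1 h')), if_neg h]
    simp

lemma zProj_mul_xProj_comm {σ : Type*} [Fintype σ] [DecidableEq σ]
    (G : Matrix κ ι (ZMod 2)) (H : Matrix σ ι (ZMod 2))
    (hc : H * Gᵀ = 0) (s : κ → ZMod 2) (t : σ → ZMod 2) :
    zProj G s * xProj H t = xProj H t * zProj G s := by
  rw [xProj, Matrix.smul_mul, Matrix.mul_smul, Matrix.sum_mul, Matrix.mul_sum]
  congr 1
  refine Finset.sum_congr rfl fun a _ => ?_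
  have : G *ᵥ (a ᵥ* H) = 0 := by
    rw [← Matrix.vecMul_transpose, Matrix.vecMul_vecMul, hc, Matrix.vecMul_zero]
  rw [Matrix.smul_mul, Matrix.mul_smul, zProj_mul_op, this, add_zero]

lemma conjTranspose_zProj (H : Matrix κ ι (ZMod 2)) (s : κ → ZMod 2) :
    (zProj H s)ᴴ = zProj H s := by
  rw [zProj, Matrix.diagonal_conjTranspose]
  congr 1
  ext v
  simp only [Pi.star_apply]
  split_ifs <;> simp

lemma conjTranspose_xProj (H : Matrix κ ι (ZMod 2)) (s : κ → ZMod 2) :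
    (xProj H s)ᴴ = xProj H s := by
  rw [xProj, Matrix.conjTranspose_smul, Matrix.conjTranspose_sum]
  congr 1
  · simp
  · refine Finset.sum_congr rfl fun a _ => ?_
    rw [Matrix.conjTranspose_smul, star_sgn, Pauli.conjTranspose_op_z_zero]

end

/-! ### Syndrome projectors of a CSS code -/

namespace CSS

variable {Q SX SZ : Type*} [Fintype Q] [DecidableEq Q] [Fintype SX] [Fintype SZ]
  [DecidableEq SX] [DecidableEq SZ] (C : CSS Q SX SZ)

/-- The syndrome of a Pauli error. -/
def synd (P : Pauli Q) : Syndrome SX SZ := (C.HX *ᵥ P.z, C.HZ *ᵥ P.x)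

lemma synProj_mul_op (s : Syndrome SX SZ) (P : Pauli Q) :
    C.synProj s * P.op = P.op * C.synProj (s + C.synd P) := by
  rw [synProj, synProj, Matrix.mul_assoc, zProj_mul_op, ← Matrix.mul_assoc, xProj_mul_op,
    Matrix.mul_assoc]
  rfl

lemma xProj_mul_zProj (s : SX → ZMod 2) (t : SZ → ZMod 2) :
    xProj C.HX s * zProj C.HZ t = zProj C.HZ t * xProj C.HX s :=
  (zProj_mul_xProj_comm _ _ C.comm t s).symm

lemma synProj_mul_synProj (s t : Syndrome SX SZ) :
    C.synProj s * C.synProj t = if s = t then C.synProj s else 0 := by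
  rw [synProj, synProj, Matrix.mul_assoc, ← Matrix.mul_assoc (zProj _ _), ← C.xProj_mul_zProj,
    Matrix.mul_assoc, zProj_mul_zProj, ← Matrix.mul_assoc, xProj_mul_xProj]
  by_cases h1 : s.1 = t.1 <;> by_cases h2 : s.2 = t.2 <;> simp [h1, h2, Prod.ext_iff]

lemma conjTranspose_codeProj : C.codeProjᴴ = C.codeProj := by
  rw [codeProj, synProj, Matrix.conjTranspose_mul, conjTranspose_zProj, conjTranspose_xProj,
    C.xProj_mul_zProj]

lemma zProj_mul_codeProj : zProj C.HZ 0 * C.codeProj = C.codeProj := by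
  rw [codeProj, synProj]
  simp only [Prod.fst_zero, Prod.snd_zero]
  rw [C.xProj_mul_zProj, ← Matrix.mul_assoc, zProj_mul_zProj, if_pos rfl]

lemma xProj_mul_codeProj : xProj C.HX 0 * C.codeProj = C.codeProj := by
  rw [codeProj, synProj]
  simp only [Prod.fst_zero, Prod.snd_zero]
  rw [← Matrix.mul_assoc, xProj_mul_xProj, if_pos rfl]

end CSS

section

/-! ### Row spaces over `ZMod 2` -/

/-- The row space is the annihilator of the kernel: the range of the dual map of `N` is the dual
annihilator of `ker N`. -/
lemma exists_vecMul_eq_of_forall_dotProduct {m n : Type*} [Fintype m] [Fintype n]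
    [DecidableEq m] [DecidableEq n] (N : Matrix m n (ZMod 2)) (x : n → ZMod 2)
    (h : ∀ y, N *ᵥ y = 0 → x ⬝ᵥ y = 0) : ∃ a, x = a ᵥ* N := by
  let φ : Module.Dual (ZMod 2) (n → ZMod 2) := dotProductBilin (ZMod 2) (ZMod 2) x
  have hφ : φ ∈ LinearMap.range N.mulVecLin.dualMap := by
    rw [LinearMap.range_dualMap_eq_dualAnnihilator_ker, Submodule.mem_dualAnnihilator]
    intro y hy
    exact h y (by simpa using hy)
  obtain ⟨ψ, hψ⟩ := hφ
  refine ⟨fun c => ψ (Pi.single c 1), ?_⟩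
  ext i
  have h1 : φ (Pi.single i 1) = x i := by simp [φ]
  rw [← h1, ← hψ, LinearMap.dualMap_apply, Matrix.mulVecLin_apply, LinearMap.pi_apply_eq_sum_univ ψ]
  have h2 : ∀ c : m, (fun j => if c = j then (1 : ZMod 2) else 0) = Pi.single c 1 := fun c => by
    ext j; simp [Pi.single_apply, eq_comm]
  simp [Matrix.vecMul, dotProduct, Matrix.col, mul_comm, h2]

/-- Duality applied to the transpose. It allows every `X`-syndrome to be represented by a `Z`-type
error. -/
lemma exists_mulVec_eq_of_vecMul_injective {m n : Type*} [Fintype m] [Fintype n]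
    [DecidableEq m] [DecidableEq n] (N : Matrix m n (ZMod 2))
    (h : ∀ a, a ᵥ* N = 0 → a = 0) (s : m → ZMod 2) : ∃ y, N *ᵥ y = s := by
  obtain ⟨a, ha⟩ := exists_vecMul_eq_of_forall_dotProduct Nᵀ s fun y hy => by
    rw [h y (by rwa [Matrix.mulVec_transpose] at hy), dotProduct_zero]
  exact ⟨a, by rw [ha, Matrix.vecMul_transpose]⟩

/-! ### Propagation of Pauli operators through the circuit -/

variable {D A : Type*} [Fintype D] [Fintype A] [DecidableEq D] [DecidableEq A]

/-- The matrix copying each data qubit to its partner. -/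
def ptMat (pt : A → Option D) : Matrix A D (ZMod 2) :=
  Matrix.of fun a q => if pt a = some q then 1 else 0

lemma ptMat_mulVec (pt : A → Option D) (v : D → ZMod 2) (a : A) :
    (ptMat pt *ᵥ v) a = (pt a).elim 0 v := by
  simp only [Matrix.mulVec, dotProduct, ptMat, Matrix.of_apply]
  cases pt a <;> simp

/-- The action of the layer of CNOTs on basis labels. -/
def cnotMap (pt : A → Option D) (v : Bits (D ⊕ A)) : Bits (D ⊕ A) :=
  Sum.elim (v ∘ Sum.inl) (v ∘ Sum.inr + ptMat pt *ᵥ (v ∘ Sum.inl))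

lemma cnotOp_apply (pt : A → Option D) (u v : Bits (D ⊕ A)) :
    cnotOp pt u v = if u = cnotMap pt v then 1 else 0 := by
  simp only [cnotOp, Matrix.of_apply]
  congr 2
  ext (q | a)
  · rfl
  · simp [cnotMap, ptMat_mulVec]
    rfl

/-- The result of propagating a Pauli operator through the layer of CNOTs. -/
def cnotPauli (pt : A → Option D) (P : Pauli (D ⊕ A)) : Pauli (D ⊕ A) where
  x := cnotMap pt P.x
  z := Sum.elim (P.z ∘ Sum.inl + (P.z ∘ Sum.inr) ᵥ* ptMat pt) (P.z ∘ Sum.inr)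

lemma dotProduct_sum {ι κ : Type*} [Fintype ι] [Fintype κ] (x y : ι ⊕ κ → ZMod 2) :
    x ⬝ᵥ y = (x ∘ Sum.inl) ⬝ᵥ (y ∘ Sum.inl) + (x ∘ Sum.inr) ⬝ᵥ (y ∘ Sum.inr) := by
  simp [dotProduct]

lemma cnotMap_add (pt : A → Option D) (v w : Bits (D ⊕ A)) :
    cnotMap pt (v + w) = cnotMap pt v + cnotMap pt w := by
  have h : (v + w) ∘ Sum.inl = v ∘ Sum.inl + w ∘ Sum.inl := rfl
  ext (q | a)
  · simp [cnotMap]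
  · simp only [cnotMap, Sum.elim_inr, h, Matrix.mulVec_add, Pi.add_apply, Function.comp_apply]
    ring

/-- The `Z`-part propagates by the inverse transpose of the action on labels; the cross term appears
twice and cancels modulo 2. -/
lemma cnotPauli_z_dotProduct (pt : A → Option D) (P : Pauli (D ⊕ A)) (v : Bits (D ⊕ A)) :
    (cnotPauli pt P).z ⬝ᵥ cnotMap pt v = P.z ⬝ᵥ v := by
  rw [dotProduct_sum, dotProduct_sum P.z]
  simp only [cnotPauli, cnotMap, Sum.elim_comp_inl, Sum.elim_comp_inr, add_dotProduct,
    dotProduct_add, Matrix.dotProduct_mulVec]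
  linear_combination CharTwo.add_self_eq_zero
    ((P.z ∘ Sum.inr) ᵥ* ptMat pt ⬝ᵥ (v ∘ Sum.inl : D → ZMod 2))

lemma cnotOp_mul_op (pt : A → Option D) (P : Pauli (D ⊕ A)) :
    cnotOp pt * P.op = (cnotPauli pt P).op * cnotOp pt := by
  ext u w
  rw [Matrix.mul_apply, Matrix.mul_apply, Finset.sum_eq_single (w + P.x),
    Finset.sum_eq_single (cnotMap pt w)]
  · simp only [cnotOp_apply, Pauli.op, Matrix.of_apply, if_true, cnotPauli_z_dotProduct, mul_one,
      cnotMap_add]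
    rw [ite_mul, one_mul, zero_mul]
    rfl
  · intro v _ hv
    simp [cnotOp_apply, hv]
  · simp
  · intro v _ hv
    simp [Pauli.op, hv]
  · simp

/-- On the ancilla, the `X`-part shifts the readout and the `Z`-part is a sign; only the data part
survives as an operator. -/
lemma readOp_mul_op (m : A → ZMod 2) (P : Pauli (D ⊕ A)) :
    readOp D m * P.op = sgn ((P.z ∘ Sum.inr) ⬝ᵥ (m + P.x ∘ Sum.inr)) •
      ((Pauli.mk (P.x ∘ Sum.inl) (P.z ∘ Sum.inl)).op * readOp D (m + P.x ∘ Sum.inr)) := by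
  ext u w
  rw [Matrix.smul_apply, Matrix.mul_apply, Matrix.mul_apply, Finset.sum_eq_single (Sum.elim u m),
    Finset.sum_eq_single (w ∘ Sum.inl)]
  · have h1 : (Sum.elim u m = w + P.x) ↔
        (u = w ∘ Sum.inl + P.x ∘ Sum.inl ∧ w ∘ Sum.inr = m + P.x ∘ Sum.inr) := by
      rw [vec_eq_add_iff (x := w ∘ Sum.inr)]
      constructor
      · intro h
        exact ⟨funext fun q => congrFun h (Sum.inl q), funext fun a => (congrFun h (Sum.inr a)).symm⟩
      · rintro ⟨h, h'⟩
        ext (q | a)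
        · exact congrFun h q
        · exact (congrFun h' a).symm
    have h2 : (w = Sum.elim (w ∘ Sum.inl) (m + P.x ∘ Sum.inr)) ↔
        w ∘ Sum.inr = m + P.x ∘ Sum.inr := by
      constructor
      · intro h; conv_lhs => rw [h]
        rfl
      · intro h; rw [← h, Sum.elim_comp_inl_inr]
    simp only [readOp, Pauli.op, Matrix.of_apply, if_true, one_mul, h1, h2, smul_eq_mul]
    by_cases hu : u = w ∘ Sum.inl + P.x ∘ Sum.inl <;>
      by_cases hw : w ∘ Sum.inr = m + P.x ∘ Sum.inr
    · rw [if_pos ⟨hu, hw⟩, if_pos hu, if_pos hw, mul_one, dotProduct_sum, sgn_add, hw, mul_comm]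
    all_goals simp [hu, hw]
  · intro v _ hv
    have : ¬ w = Sum.elim v (m + P.x ∘ Sum.inr) := by
      rintro rfl; exact hv rfl
    simp [readOp, this]
  · simp
  · intro v _ hv
    simp [readOp, hv]
  · simp

lemma op_z_mul_prepOp (z : A → ZMod 2) :
    (Pauli.mk (0 : D ⊕ A → ZMod 2) (Sum.elim 0 z)).op * prepOp D A = prepOp D A := by
  ext u v
  rw [Pauli.op_x_zero, Matrix.diagonal_mul]
  by_cases h : u = Sum.elim v 0
  · have : (Sum.elim 0 z : D ⊕ A → ZMod 2) ⬝ᵥ u = 0 := by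
      rw [h, dotProduct_sum]; simp
    rw [this, sgn_zero, one_mul]
  · simp [prepOp, h]

lemma zProj_mul_prepOp {κ : Type*} [Fintype κ] [DecidableEq κ] (H : Matrix κ A (ZMod 2))
    (s : κ → ZMod 2) :
    zProj (Matrix.fromCols (0 : Matrix κ D (ZMod 2)) H) s * prepOp D A =
      if s = 0 then prepOp D A else 0 := by
  ext u v
  rw [zProj, Matrix.diagonal_mul]
  by_cases h : u = Sum.elim v 0
  · have : Matrix.fromCols (0 : Matrix κ D (ZMod 2)) H *ᵥ u = 0 := by
      rw [h, Matrix.fromCols_mulVec]; simp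
    rw [this]
    by_cases hs : s = 0
    · simp [hs]
    · simp [hs, Ne.symm hs]
  · split_ifs <;> simp [prepOp, h]

/-- A `Z`-type error fixes the prepared ancilla but moves the `X`-syndrome. A random syndrome is
therefore the trivial one followed by a `Z`-type frame. -/
lemma xProj_mul_prepOp {κ : Type*} [Fintype κ] [DecidableEq κ] (H : Matrix κ A (ZMod 2))
    (z : A → ZMod 2) :
    xProj (Matrix.fromCols (0 : Matrix κ D (ZMod 2)) H) (H *ᵥ z) * prepOp D A =
      (Pauli.mk (0 : D ⊕ A → ZMod 2) (Sum.elim 0 z)).op *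
        (xProj (Matrix.fromCols (0 : Matrix κ D (ZMod 2)) H) 0 * prepOp D A) := by
  conv_lhs => rw [← op_z_mul_prepOp z, ← Matrix.mul_assoc, xProj_mul_op, Matrix.mul_assoc]
  rw [Matrix.fromCols_mulVec]
  simp [vec_add_self]

lemma readOp_mul_cnotOp_mul_prepOp (pt : A → Option D) (m : A → ZMod 2) :
    readOp D m * (cnotOp pt * prepOp D A) =
      Matrix.diagonal fun v => if m = ptMat pt *ᵥ v then (1 : ℂ) else 0 := by
  have h1 : cnotOp pt * prepOp D A =
      Matrix.of fun u v => if u = Sum.elim v (ptMat pt *ᵥ v) then (1 : ℂ) else 0 := by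
    ext u v
    rw [Matrix.mul_apply, Finset.sum_eq_single (Sum.elim v 0)]
    · simp only [cnotOp_apply, prepOp, Matrix.of_apply, if_true, mul_one, cnotMap,
        Sum.elim_comp_inl, Sum.elim_comp_inr, zero_add]
    · intro w _ hw
      simp [prepOp, hw]
    · simp
  rw [h1]
  ext u v
  rw [Matrix.mul_apply, Finset.sum_eq_single (Sum.elim u m), Matrix.diagonal_apply]
  · have : (Sum.elim u m = Sum.elim v (ptMat pt *ᵥ v)) ↔ u = v ∧ m = ptMat pt *ᵥ v := by
      constructor
      · intro h
        exact ⟨funext fun q => congrFun h (Sum.inl q), funext fun a => congrFun h (Sum.inr a)⟩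
      · rintro ⟨rfl, h⟩; rw [← h]
    simp only [readOp, Matrix.of_apply, if_true, one_mul, this]
    by_cases h : u = v
    · subst h; simp
    · simp [h]
  · intro w _ hw
    simp [readOp, hw]
  · simp

/-- Expanding the projector, each product of `X`-checks acts on CNOT targets, passes the CNOTs
unchanged and translates the readout. Since the rows are independent, at most one term hits a given
pair of label and readout. -/
lemma readOp_mul_cnotOp_mul_xProj {κ : Type*} [Fintype κ] [DecidableEq κ]
    (pt : A → Option D) (H : Matrix κ A (ZMod 2)) (hH : ∀ a, a ᵥ* H = 0 → a = 0)
    (m : A → ZMod 2) :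
    readOp D m * (cnotOp pt *
        (xProj (Matrix.fromCols (0 : Matrix κ D (ZMod 2)) H) 0 * prepOp D A)) =
      ((2 : ℂ) ^ Fintype.card κ)⁻¹ •
        Matrix.diagonal fun v => open Classical in
          if ∃ a, a ᵥ* H = m + ptMat pt *ᵥ v then (1 : ℂ) else 0 := by
  have h1 : ∀ a : κ → ZMod 2, readOp D m * (cnotOp pt *
      ((Pauli.mk (a ᵥ* Matrix.fromCols (0 : Matrix κ D (ZMod 2)) H) 0).op * prepOp D A)) =
      Matrix.diagonal fun v => if m + a ᵥ* H = ptMat pt *ᵥ v then (1 : ℂ) else 0 := fun a => by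
    have hx : (a ᵥ* Matrix.fromCols (0 : Matrix κ D (ZMod 2)) H) =
        (Sum.elim 0 (a ᵥ* H) : D ⊕ A → ZMod 2) := by
      rw [Matrix.vecMul_fromCols]; simp
    have hP : cnotPauli pt ⟨Sum.elim 0 (a ᵥ* H), 0⟩ = ⟨Sum.elim 0 (a ᵥ* H), 0⟩ := by
      have h0 : ((0 : D ⊕ A → ZMod 2) ∘ Sum.inr : A → ZMod 2) = 0 := rfl
      have h0' : ((0 : D ⊕ A → ZMod 2) ∘ Sum.inl : D → ZMod 2) = 0 := rfl
      simp [cnotPauli, cnotMap, h0, h0']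
    have h0 : ((0 : D ⊕ A → ZMod 2) ∘ Sum.inr : A → ZMod 2) = 0 := rfl
    have h0' : ((0 : D ⊕ A → ZMod 2) ∘ Sum.inl : D → ZMod 2) = 0 := rfl
    rw [hx, ← Matrix.mul_assoc (cnotOp pt), cnotOp_mul_op, hP, Matrix.mul_assoc,
      ← Matrix.mul_assoc, readOp_mul_op, h0, h0', zero_dotProduct, sgn_zero, one_smul,
      Sum.elim_comp_inl, Sum.elim_comp_inr, Pauli.op_zero, Matrix.one_mul,
      readOp_mul_cnotOp_mul_prepOp]
  rw [xProj, Matrix.smul_mul, Matrix.mul_smul, Matrix.mul_smul, Matrix.sum_mul, Matrix.mul_sum,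
    Matrix.mul_sum]
  congr 1
  simp only [dotProduct_zero, sgn_zero, one_smul, h1]
  ext u v
  rw [Matrix.sum_apply]
  by_cases huv : u = v
  · subst huv
    simp only [Matrix.diagonal_apply_eq]
    split_ifs with h
    · obtain ⟨a, ha⟩ := h
      rw [Finset.sum_eq_single a]
      · rw [if_pos]; rw [ha, ← add_assoc, vec_add_self, zero_add]
      · intro b _ hb
        rw [if_neg]
        intro h
        refine hb (vec_add_eq_zero.1 (hH _ ?_))
        rw [Matrix.add_vecMul, ha, ← h, ← add_assoc, add_comm _ m, vec_add_self]
      · simp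
    · refine Finset.sum_eq_zero fun a _ => if_neg fun ha => h ⟨a, ?_⟩
      rw [← ha, ← add_assoc, vec_add_self, zero_add]
  · simp [Matrix.diagonal_apply_ne _ huv]

end

section

/-! ### Repeated syndrome measurement -/

lemma Syndrome.add_add_self {SX SZ : Type*} (s t : Syndrome SX SZ) : s + t + t = s := by
  rw [add_assoc]
  ext c <;> simp [CharTwo.add_self_eq_zero]

/-- Starting from a definite syndrome, every later outcome is forced to be that syndrome plus the
syndromes of all errors so far. Then the projectors are absorbed and only the product of the errors
remains; otherwise two orthogonal projectors meet. -/
lemma foldl_synProj {Q SX SZ κ : Type*} [Fintype Q] [DecidableEq Q] [Fintype SX] [Fintype SZ]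
    [DecidableEq SX] [DecidableEq SZ] (C : CSS Q SX SZ) {d : ℕ} (P : Fin d → Pauli Q)
    (s : Fin d → Syndrome SX SZ) (s₀ : Syndrome SX SZ) (X : Op Q κ) :
    PhaseEq (Fin.foldl d (fun M t => C.synProj (s t) * ((P t).op * M)) (C.synProj s₀ * X))
      (open Classical in
        if ∀ t, s t = s₀ + ∑ t', if t' ≤ t then C.synd (P t') else 0 then
          (Pauli.mk (∑ t, (P t).x) (∑ t, (P t).z)).op * (C.synProj s₀ * X) else 0) := by
  induction d generalizing s₀ X with
  | zero =>
    apply PhaseEq.of_eq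
    simp [Pauli.op_zero]
  | succ d ih =>
    rw [Fin.foldl_succ]
    have h1 : C.synProj (s 0) * ((P 0).op * (C.synProj s₀ * X)) =
        (P 0).op * ((C.synProj (s 0 + C.synd (P 0)) * C.synProj s₀) * X) := by
      rw [← Matrix.mul_assoc, C.synProj_mul_op]
      simp only [Matrix.mul_assoc]
    by_cases h : s 0 = s₀ + C.synd (P 0)
    · have h0 : s 0 + C.synd (P 0) = s₀ := by
        rw [h, Syndrome.add_add_self]
      -- The outcome agrees with the forced one, so the earlier projector is redundant, and the
      -- induction restarts from syndrome `s 0`.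
      have h2 : C.synProj (s 0) * ((P 0).op * (C.synProj s₀ * X)) =
          C.synProj (s 0) * ((P 0).op * X) := by
        rw [h1, h0, C.synProj_mul_synProj, if_pos rfl, ← Matrix.mul_assoc (C.synProj (s 0)),
          C.synProj_mul_op, h0, Matrix.mul_assoc]
      rw [h2]
      refine (ih (fun t => P t.succ) (fun t => s t.succ) (s 0) ((P 0).op * X)).trans ?_
      have hc : (∀ t : Fin d, s t.succ = s 0 + ∑ t', if t' ≤ t then C.synd (P t'.succ) else 0) ↔
          ∀ t, s t = s₀ + ∑ t', if t' ≤ t then C.synd (P t') else 0 := by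
        rw [Fin.forall_fin_succ]
        simp only [Fin.sum_univ_succ, Fin.zero_le, if_true, Fin.succ_le_succ_iff, ← add_assoc, ← h]
        constructor
        · intro h'
          refine ⟨?_, h'⟩
          rw [Finset.sum_eq_zero, add_zero]
          intro t _
          rw [if_neg]
          simp
        · exact fun h' => h'.2
      by_cases hs : ∀ t, s t = s₀ + ∑ t', if t' ≤ t then C.synd (P t') else 0
      · rw [if_pos (hc.2 hs), if_pos hs, ← Matrix.mul_assoc (C.synProj (s 0)), C.synProj_mul_op, h0,
          ← Matrix.mul_assoc, ← Matrix.mul_assoc, Matrix.mul_assoc (_ * _)]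
        refine ((Pauli.op_mul_phaseEq _ _).mul_right _).trans (.of_eq ?_)
        simp only [Fin.sum_univ_succ, add_comm]
      · rw [if_neg (fun h' => hs (hc.1 h')), if_neg hs]
        exact .refl _
    · have h0 : ¬ s 0 + C.synd (P 0) = s₀ := by
        rintro rfl
        refine h ?_
        rw [Syndrome.add_add_self]
      have h2 := ih (fun t => P t.succ) (fun t => s t.succ) 0 (0 : Op Q κ)
      rw [h1, C.synProj_mul_synProj, if_neg h0, Matrix.zero_mul, Matrix.mul_zero]
      rw [Matrix.mul_zero, Matrix.mul_zero, ite_self] at h2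
      rw [h2.eq_zero, if_neg]
      · exact .refl _
      · intro h'
        refine h ?_
        rw [h' 0, Fin.sum_univ_succ]
        simp

/-- The first check projector, moved back before its error, can be duplicated. This supplies the
definite initial syndrome although the prepared state has none for the `X`-checks. -/
lemma foldl_synProj_init {Q SX SZ κ : Type*} [Fintype Q] [DecidableEq Q] [Fintype SX] [Fintype SZ]
    [DecidableEq SX] [DecidableEq SZ] (C : CSS Q SX SZ) {d : ℕ} (P : Fin (d + 1) → Pauli Q)
    (s : Fin (d + 1) → Syndrome SX SZ) (X : Op Q κ) :
    Fin.foldl (α := Op Q κ) (d + 1) (fun (M : Op Q κ) t => C.synProj (s t) * ((P t).op * M)) X =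
      Fin.foldl (α := Op Q κ) (d + 1) (fun (M : Op Q κ) t => C.synProj (s t) * ((P t).op * M))
        (C.synProj (s 0 + C.synd (P 0)) * X) := by
  have key : ∀ Y : Op Q κ, C.synProj (s 0) * ((P 0).op * Y) =
      (P 0).op * (C.synProj (s 0 + C.synd (P 0)) * Y) := fun Y => by
    rw [← Matrix.mul_assoc, C.synProj_mul_op, Matrix.mul_assoc]
  rw [Fin.foldl_succ, Fin.foldl_succ, key, key, ← Matrix.mul_assoc (C.synProj _) (C.synProj _),
    C.synProj_mul_synProj, if_pos rfl]

/-! ### Operators of a run -/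

variable {D A : Type*} [Fintype D] [Fintype A] [DecidableEq D] [DecidableEq A]
variable {SX SZ TX TZ : Type*} [Fintype SX] [Fintype SZ] [DecidableEq SX] [DecidableEq SZ]
variable [Fintype TX] [Fintype TZ] [DecidableEq TX] [DecidableEq TZ]

namespace Faults

variable {d : ℕ} (F : Faults D A TX TZ d)

/-- The `X`-part of the product of the errors before the CNOTs. -/
def totX : D ⊕ A → ZMod 2 := ∑ t, (F.idle t).x

/-- The `Z`-part of the product of the errors before the CNOTs. -/
def totZ : D ⊕ A → ZMod 2 := ∑ t, (F.idle t).z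

/-- The effective error of the ancilla readout. -/
def readError (pt : A → Option D) : A → ZMod 2 :=
  F.readout + F.cnot.x ∘ Sum.inr + (F.totX ∘ Sum.inr + ptMat pt *ᵥ (F.totX ∘ Sum.inl))

/-- The Pauli error of the data qubits after a run in which the `X`-checks of the ancilla code
have been projected to the syndrome of the `Z`-type error `z`. -/
def resid (pt : A → Option D) (z : A → ZMod 2) : Pauli D where
  x := F.totX ∘ Sum.inl + F.cnot.x ∘ Sum.inl
  z := F.totZ ∘ Sum.inl + F.cnot.z ∘ Sum.inl + (F.totZ ∘ Sum.inr + z) ᵥ* ptMat pt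

/-- The check outcomes of a run are possible if `s` is the outcome of the `X`-checks of the ancilla
code in the absence of faults. -/
def Consistent (C' : CSS A TX TZ) (s : TX → ZMod 2) (r : Record A TX TZ d) : Prop :=
  ∀ t, r.1 t + F.flip t = (s, 0) + ∑ t' : Fin d,
    if t' ≤ t then (C'.onAncilla D).synd (F.idle t'.castSucc) else 0

end Faults

/-- The measurement of the checks in all the rounds, with the faults up to the last round, after
the preparation of the ancilla qubits. -/
def roundsOp (C' : CSS A TX TZ) {d : ℕ} (F : Faults D A TX TZ d) (r : Record A TX TZ d) :
    Op (D ⊕ A) D :=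
  Fin.foldl (α := Op (D ⊕ A) D) d
    (fun (M : Op (D ⊕ A) D) t =>
      (C'.onAncilla D).synProj (r.1 t + F.flip t) * ((F.idle t.castSucc).op * M))
    (prepOp D A)

/-- On the all-zero ancilla the `Z`-checks are deterministic; only the `X`-outcomes are free. -/
lemma synProj_onAncilla_mul_prepOp (C' : CSS A TX TZ) (s : Syndrome TX TZ) :
    (C'.onAncilla D).synProj s * prepOp D A =
      if s.2 = 0 then xProj (C'.onAncilla D).HX s.1 * prepOp D A else 0 := by
  rw [CSS.synProj, Matrix.mul_assoc]
  simp only [CSS.onAncilla]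
  rw [zProj_mul_prepOp]
  split_ifs <;> simp

lemma roundsOp_phaseEq (C' : CSS A TX TZ) {d : ℕ} (F : Faults D A TX TZ (d + 1))
    (r : Record A TX TZ (d + 1)) (s₀ : Syndrome TX TZ)
    (h₀ : s₀ = r.1 0 + F.flip 0 + (C'.onAncilla D).synd (F.idle (Fin.castSucc 0))) :
    PhaseEq (roundsOp C' F r) (open Classical in
      if ∀ t, r.1 t + F.flip t = s₀ + ∑ t' : Fin (d + 1),
          if t' ≤ t then (C'.onAncilla D).synd (F.idle t'.castSucc) else 0 then
        (Pauli.mk (∑ t : Fin (d + 1), (F.idle t.castSucc).x)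
          (∑ t : Fin (d + 1), (F.idle t.castSucc).z)).op *
          (if s₀.2 = 0 then xProj (C'.onAncilla D).HX s₀.1 * prepOp D A else 0) else 0) := by
  rw [← synProj_onAncilla_mul_prepOp, roundsOp, h₀,
    foldl_synProj_init (C'.onAncilla D) (fun t => F.idle t.castSucc) (fun t => r.1 t + F.flip t)]
  exact foldl_synProj (C'.onAncilla D) (fun t => F.idle t.castSucc) (fun t => r.1 t + F.flip t) _ _

lemma Faults.Consistent.eq {C' : CSS A TX TZ} {d : ℕ} {F : Faults D A TX TZ (d + 1)}
    {r : Record A TX TZ (d + 1)} {s : TX → ZMod 2} (h : F.Consistent C' s r) :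
    (s, 0) = r.1 0 + F.flip 0 + (C'.onAncilla D).synd (F.idle (Fin.castSucc 0)) := by
  rw [h 0, Fin.sum_univ_succ, if_pos le_rfl, Finset.sum_eq_zero, add_zero, Syndrome.add_add_self]
  intro t _
  rw [if_neg]
  simp

lemma roundsOp_of_consistent (C' : CSS A TX TZ) {d : ℕ} (F : Faults D A TX TZ (d + 1))
    (r : Record A TX TZ (d + 1)) (s : TX → ZMod 2) (h : F.Consistent C' s r) :
    PhaseEq (roundsOp C' F r)
      ((Pauli.mk (∑ t : Fin (d + 1), (F.idle t.castSucc).x)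
        (∑ t : Fin (d + 1), (F.idle t.castSucc).z)).op *
        (xProj (C'.onAncilla D).HX s * prepOp D A)) := by
  refine (roundsOp_phaseEq C' F r (s, 0) h.eq).trans (.of_eq ?_)
  rw [Faults.Consistent] at h
  rw [if_pos h, if_pos rfl]

lemma roundsOp_eq_zero (C' : CSS A TX TZ) {d : ℕ} (F : Faults D A TX TZ (d + 1))
    (r : Record A TX TZ (d + 1)) (h : ¬ ∃ s, F.Consistent C' s r) : roundsOp C' F r = 0 := by
  refine PhaseEq.eq_zero ((roundsOp_phaseEq C' F r _ rfl).trans (.of_eq ?_))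
  split_ifs with h1 h2
  · refine (h ⟨(r.1 0 + F.flip 0 + (C'.onAncilla D).synd (F.idle (Fin.castSucc 0))).1,
      fun t => (h1 t).trans ?_⟩).elim
    congr 1
    exact Prod.ext rfl h2
  · rw [Matrix.mul_zero]
  · rfl

lemma kraus_eq_roundsOp (C' : CSS A TX TZ) (pt : A → Option D) {d : ℕ} (F : Faults D A TX TZ d)
    (r : Record A TX TZ d) : kraus C' pt F r =
      readOp D (r.2 + F.readout) * F.cnot.op * cnotOp pt * (F.idle (Fin.last d)).op *
        roundsOp C' F r := rfl

lemma readOp_mul_op_phaseEq (m : A → ZMod 2) (P : Pauli (D ⊕ A)) :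
    PhaseEq (readOp D m * P.op)
      ((Pauli.mk (P.x ∘ Sum.inl) (P.z ∘ Sum.inl)).op * readOp D (m + P.x ∘ Sum.inr)) := by
  rw [readOp_mul_op]
  exact .of_sgn_smul _ _

/-- `Q` sits before the CNOTs and spreads: its `X`-part from data to ancilla, its `Z`-part from
ancilla to data. `P` sits after them and does not. -/
lemma readOp_mul_op_mul_cnotOp_mul_op {κ : Type*} (pt : A → Option D) (m : A → ZMod 2)
    (P Q : Pauli (D ⊕ A)) (Y : Op (D ⊕ A) κ) :
    PhaseEq (readOp D m * P.op * cnotOp pt * (Q.op * Y))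
      ((Pauli.mk (Q.x ∘ Sum.inl + P.x ∘ Sum.inl)
          (Q.z ∘ Sum.inl + P.z ∘ Sum.inl + (Q.z ∘ Sum.inr) ᵥ* ptMat pt)).op *
        (readOp D (m + (P.x ∘ Sum.inr + (Q.x ∘ Sum.inr + ptMat pt *ᵥ (Q.x ∘ Sum.inl)))) *
          (cnotOp pt * Y))) := by
  have h1 : readOp D m * P.op * cnotOp pt * (Q.op * Y) =
      readOp D m * (P.op * (cnotPauli pt Q).op) * (cnotOp pt * Y) := by
    rw [← Matrix.mul_assoc _ Q.op, Matrix.mul_assoc _ (cnotOp pt), cnotOp_mul_op]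
    simp only [Matrix.mul_assoc]
  rw [h1]
  refine (((Pauli.op_mul_phaseEq _ _).mul_left _).mul_right _).trans ?_
  refine ((readOp_mul_op_phaseEq _ _).mul_right _).trans (.of_eq ?_)
  rw [Matrix.mul_assoc]
  congr 3
  · exact add_comm _ _
  · change P.z ∘ Sum.inl + (Q.z ∘ Sum.inl + (Q.z ∘ Sum.inr) ᵥ* ptMat pt) = _
    abel

/-- The operator of a run with possible check outcomes. -/
lemma kraus_of_consistent (C' : CSS A TX TZ) (pt : A → Option D) {d : ℕ}
    (F : Faults D A TX TZ (d + 1)) (r : Record A TX TZ (d + 1))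
    (hC' : ∀ a, a ᵥ* C'.HX = 0 → a = 0) (z : A → ZMod 2) (h : F.Consistent C' (C'.HX *ᵥ z) r) :
    PhaseEq (kraus C' pt F r) ((F.resid pt z).op * (((2 : ℂ) ^ Fintype.card TX)⁻¹ •
        Matrix.diagonal fun v => open Classical in
          if ∃ a, a ᵥ* C'.HX = r.2 + F.readError pt + ptMat pt *ᵥ v then (1 : ℂ) else 0)) := by
  rw [kraus_eq_roundsOp, ← readOp_mul_cnotOp_mul_xProj pt C'.HX hC']
  refine ((roundsOp_of_consistent C' F r _ h).mul_left _).trans ?_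
  simp only [CSS.onAncilla]
  rw [xProj_mul_prepOp, Matrix.mul_assoc _ (F.idle (Fin.last (d + 1))).op,
    ← Matrix.mul_assoc _ _ (_ * prepOp D A), ← Matrix.mul_assoc (F.idle (Fin.last (d + 1))).op]
  refine (((((Pauli.op_mul_phaseEq _ _).mul_left _).trans
    (Pauli.op_mul_phaseEq _ _)).mul_right _).mul_left _).trans ?_
  refine (readOp_mul_op_mul_cnotOp_mul_op _ _ _ _ _).trans (.of_eq ?_)
  have hx : (F.idle (Fin.last (d + 1))).x + (∑ t : Fin (d + 1), (F.idle t.castSucc).x + 0) =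
      F.totX := by
    rw [Faults.totX, Fin.sum_univ_castSucc (n := d + 1), add_zero, add_comm]
  have hz : (F.idle (Fin.last (d + 1))).z +
      (∑ t : Fin (d + 1), (F.idle t.castSucc).z + (Sum.elim 0 z : D ⊕ A → ZMod 2)) =
        F.totZ + (Sum.elim 0 z : D ⊕ A → ZMod 2) := by
    rw [Faults.totZ, Fin.sum_univ_castSucc (n := d + 1), ← add_assoc, add_comm (F.idle _).z]
  simp only [hx, hz]
  congr 1
  · congr 1
    rw [Faults.resid]
    congr 2
    ext q
    simp
  · rw [add_assoc r.2, Faults.readError, add_assoc F.readout]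

lemma kraus_eq_zero (C' : CSS A TX TZ) (pt : A → Option D) {d : ℕ}
    (F : Faults D A TX TZ (d + 1)) (r : Record A TX TZ (d + 1))
    (h : ¬ ∃ s, F.Consistent C' s r) : kraus C' pt F r = 0 := by
  rw [kraus_eq_roundsOp, roundsOp_eq_zero C' F r h, Matrix.mul_zero]

end

section

variable {D A : Type*} [Fintype D] [Fintype A] [DecidableEq D] [DecidableEq A]
variable {SX SZ TX TZ : Type*} [Fintype SX] [Fintype SZ] [DecidableEq SX] [DecidableEq SZ]
variable [Fintype TX] [Fintype TZ] [DecidableEq TX] [DecidableEq TZ]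
variable {κ : Type*} [Fintype κ] [DecidableEq κ]

/-! ### Runs on the code space -/

/-- The algebraic conditions under which the circuit measures the `Z`-type operators `M`. -/
structure IsSteaneGadget (C : CSS D SX SZ) (C' : CSS A TX TZ) (pt : A → Option D)
    (M : Matrix κ D (ZMod 2)) : Prop where
  injective : ∀ a b q, pt a = some q → pt b = some q → a = b
  rows_indep : ∀ a, a ᵥ* C'.HX = 0 → a = 0
  restrict : ∃ R : Matrix TZ SZ (ZMod 2), C'.HZ * ptMat pt = R * C.HZ
  exact_at : ∀ x, C'.HZ *ᵥ x = 0 → (M * (ptMat pt)ᵀ) *ᵥ x = 0 → ∃ a, x = a ᵥ* C'.HX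
  logical_ancilla : M * (ptMat pt)ᵀ * C'.HXᵀ = 0
  logical_data : M * C.HXᵀ = 0
  support : M * (ptMat pt)ᵀ * ptMat pt = M

variable {C : CSS D SX SZ} {C' : CSS A TX TZ} {pt : A → Option D} {M : Matrix κ D (ZMod 2)}

namespace IsSteaneGadget

lemma HZ_mulVec_ptMat (h : IsSteaneGadget C C' pt M) {v : D → ZMod 2} (hv : C.HZ *ᵥ v = 0) :
    C'.HZ *ᵥ (ptMat pt *ᵥ v) = 0 := by
  obtain ⟨R, hR⟩ := h.restrict
  rw [Matrix.mulVec_mulVec, hR, ← Matrix.mulVec_mulVec, hv, Matrix.mulVec_zero]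

lemma logical_mulVec_ptMat (h : IsSteaneGadget C C' pt M) (v : D → ZMod 2) :
    (M * (ptMat pt)ᵀ) *ᵥ (ptMat pt *ᵥ v) = M *ᵥ v := by
  rw [Matrix.mulVec_mulVec, h.support]

lemma logical_mulVec_row (h : IsSteaneGadget C C' pt M) (a : TX → ZMod 2) :
    (M * (ptMat pt)ᵀ) *ᵥ (a ᵥ* C'.HX) = 0 := by
  rw [← Matrix.mulVec_transpose, Matrix.mulVec_mulVec, h.logical_ancilla, Matrix.zero_mulVec]

end IsSteaneGadget

lemma CSS.HZ_mulVec_row (C : CSS D SX SZ) (a : SX → ZMod 2) : C.HZ *ᵥ (a ᵥ* C.HX) = 0 := by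
  rw [← Matrix.vecMul_transpose, Matrix.vecMul_vecMul, C.comm, Matrix.vecMul_zero]

/-- For a label satisfying the data `Z`-checks, its copy satisfies the ancilla `Z`-checks and has
the same measured parities. By exactness, the indicator then tests one condition on the readout and
one on the measured parities. -/
lemma diagonal_mul_codeProj (h : IsSteaneGadget C C' pt M) (m : A → ZMod 2) :
    (Matrix.diagonal fun v => open Classical in
      if ∃ a, a ᵥ* C'.HX = m + ptMat pt *ᵥ v then (1 : ℂ) else 0) * C.codeProj =
    if C'.HZ *ᵥ m = 0 then zProj M ((M * (ptMat pt)ᵀ) *ᵥ m) * C.codeProj else 0 := by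
  rw [← C.zProj_mul_codeProj, ← Matrix.mul_assoc, ← Matrix.mul_assoc]
  have key : ∀ v, C.HZ *ᵥ v = 0 → ((∃ a, a ᵥ* C'.HX = m + ptMat pt *ᵥ v) ↔
      C'.HZ *ᵥ m = 0 ∧ M *ᵥ v = (M * (ptMat pt)ᵀ) *ᵥ m) := by
    intro v hv
    constructor
    · rintro ⟨a, ha⟩
      constructor
      · have := C'.HZ_mulVec_row a
        rwa [ha, Matrix.mulVec_add, h.HZ_mulVec_ptMat hv, add_zero] at this
      · have := h.logical_mulVec_row a
        rw [ha, Matrix.mulVec_add, h.logical_mulVec_ptMat, vec_add_eq_zero] at this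
        exact this.symm
    · rintro ⟨h1, h2⟩
      obtain ⟨a, ha⟩ := h.exact_at (m + ptMat pt *ᵥ v)
        (by rw [Matrix.mulVec_add, h.HZ_mulVec_ptMat hv, h1, add_zero])
        (by rw [Matrix.mulVec_add, h.logical_mulVec_ptMat, h2, vec_add_self])
      exact ⟨a, ha.symm⟩
  split_ifs with hm
  · congr 1
    rw [zProj, zProj, Matrix.diagonal_mul_diagonal, Matrix.diagonal_mul_diagonal]
    congr 1
    ext v
    by_cases hv : C.HZ *ᵥ v = 0
    · rw [if_pos hv, mul_one, mul_one]
      exact if_congr ((key v hv).trans (and_iff_right hm)) rfl rfl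
    · rw [if_neg hv, mul_zero, mul_zero]
  · rw [zProj, Matrix.diagonal_mul_diagonal]
    convert Matrix.zero_mul _
    rw [← Matrix.diagonal_zero]
    congr 1
    ext v
    by_cases hv : C.HZ *ᵥ v = 0
    · rw [if_neg, zero_mul]
      exact fun h' => hm ((key v hv).1 h').1
    · rw [if_neg hv, mul_zero]

section

variable {d : ℕ} (F : Faults D A TX TZ (d + 1)) (r : Record A TX TZ (d + 1))

lemma kraus_mul_codeProj (h : IsSteaneGadget C C' pt M) (z : A → ZMod 2)
    (hs : F.Consistent C' (C'.HX *ᵥ z) r) (hm : C'.HZ *ᵥ (r.2 + F.readError pt) = 0) :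
    PhaseEq (kraus C' pt F r * C.codeProj) ((F.resid pt z).op * (((2 : ℂ) ^ Fintype.card TX)⁻¹ •
      (zProj M ((M * (ptMat pt)ᵀ) *ᵥ (r.2 + F.readError pt)) * C.codeProj))) := by
  refine ((kraus_of_consistent C' pt F r h.rows_indep z hs).mul_right _).trans (.of_eq ?_)
  rw [Matrix.mul_assoc, Matrix.smul_mul, diagonal_mul_codeProj h, if_pos hm]

lemma kraus_mul_codeProj_eq_zero (h : IsSteaneGadget C C' pt M)
    (hr : ¬ ((∃ s, F.Consistent C' s r) ∧ C'.HZ *ᵥ (r.2 + F.readError pt) = 0)) :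
    kraus C' pt F r * C.codeProj = 0 := by
  by_cases hs : ∃ s, F.Consistent C' s r
  · obtain ⟨s, hs'⟩ := hs
    obtain ⟨z, rfl⟩ := exists_mulVec_eq_of_vecMul_injective _ h.rows_indep s
    refine PhaseEq.eq_zero
      (((kraus_of_consistent C' pt F r h.rows_indep z hs').mul_right _).trans (.of_eq ?_))
    rw [Matrix.mul_assoc, Matrix.smul_mul, diagonal_mul_codeProj h,
      if_neg (fun hm => hr ⟨⟨_, hs'⟩, hm⟩), smul_zero, Matrix.mul_zero]
  · rw [kraus_eq_zero C' pt F r hs, Matrix.zero_mul]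

end

lemma conj_mul_codeProj (K ρ : Op D D) (hρ : C.codeProj * ρ * C.codeProj = ρ) :
    K * ρ * Kᴴ = (K * C.codeProj) * ρ * (K * C.codeProj)ᴴ := by
  conv_lhs => rw [← hρ]
  rw [Matrix.conjTranspose_mul, C.conjTranspose_codeProj]
  simp only [Matrix.mul_assoc]

lemma conj_eq_of_phaseEq (K ρ : Op D D) (hρ : C.codeProj * ρ * C.codeProj = ρ) (n : ℕ)
    (ν : κ → ZMod 2)
    (hK : PhaseEq (K * C.codeProj) (((2 : ℂ) ^ n)⁻¹ • (zProj M ν * C.codeProj))) :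
    K * ρ * Kᴴ = (((2 : ℂ) ^ n)⁻¹ * ((2 : ℂ) ^ n)⁻¹) • (zProj M ν * ρ * zProj M ν) := by
  have h1 : star (((2 : ℂ) ^ n)⁻¹) = ((2 : ℂ) ^ n)⁻¹ := by simp
  rw [conj_mul_codeProj K ρ hρ, hK.conj, Matrix.conjTranspose_smul, h1, Matrix.smul_mul,
    Matrix.smul_mul, Matrix.mul_smul, smul_smul, ← conj_mul_codeProj _ _ hρ, conjTranspose_zProj]

/-- This covers impossible outcomes, for which no record can be constructed in `sum_record` and both
sides vanish. -/
lemma zProj_mul_codeProj_eq_zero (μ : κ → ZMod 2) (h : ¬ ∃ v, C.HZ *ᵥ v = 0 ∧ M *ᵥ v = μ) :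
    zProj M μ * C.codeProj = 0 := by
  rw [← C.zProj_mul_codeProj, ← Matrix.mul_assoc, zProj, zProj, Matrix.diagonal_mul_diagonal]
  convert Matrix.zero_mul _
  rw [← Matrix.diagonal_zero]
  congr 1
  ext v
  by_cases hv : C.HZ *ᵥ v = 0
  · rw [if_neg (fun h' => h ⟨v, hv, h'⟩), zero_mul]
  · rw [if_neg hv, mul_zero]

/-- The contributing records of a possible outcome are in bijection with pairs of an `X`-syndrome
and a combination of `X`-checks added to the readout. Their number is the square of `2 ^
Fintype.card TX`, exactly cancelling the weight of each term. -/
lemma sum_record (h : IsSteaneGadget C C' pt M) {d : ℕ} (F : Faults D A TX TZ (d + 1))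
    (ρ : Op D D) (hρ : C.codeProj * ρ * C.codeProj = ρ)
    (out : Record A TX TZ (d + 1) → κ → ZMod 2) (T : Record A TX TZ (d + 1) → Op D D)
    (h0 : ∀ r, ¬ ((∃ s, F.Consistent C' s r) ∧ C'.HZ *ᵥ (r.2 + F.readError pt) = 0) → T r = 0)
    (h1 : ∀ r s, F.Consistent C' s r → C'.HZ *ᵥ (r.2 + F.readError pt) = 0 →
      out r = (M * (ptMat pt)ᵀ) *ᵥ (r.2 + F.readError pt) ∧
      T r = (((2 : ℂ) ^ Fintype.card TX)⁻¹ * ((2 : ℂ) ^ Fintype.card TX)⁻¹) •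
        (zProj M ((M * (ptMat pt)ᵀ) *ᵥ (r.2 + F.readError pt)) * ρ *
          zProj M ((M * (ptMat pt)ᵀ) *ᵥ (r.2 + F.readError pt)))) (μ : κ → ZMod 2) :
    ∑ r : Record A TX TZ (d + 1) with out r = μ, T r = zProj M μ * ρ * zProj M μ := by
  by_cases hv : ∃ v, C.HZ *ᵥ v = 0 ∧ M *ᵥ v = μ
  · obtain ⟨v, hv, rfl⟩ := hv
    -- `p.1` is the random `X`-syndrome, which with `F` fixes all check outcomes. `p.2` ranges over
    -- the ancilla codeword added to the copy of a fixed label `v` with outcome `μ`.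
    let Φ : (TX → ZMod 2) × (TX → ZMod 2) → Record A TX TZ (d + 1) := fun p =>
      (fun t => (p.1, 0) + (∑ t' : Fin (d + 1),
        if t' ≤ t then (C'.onAncilla D).synd (F.idle t'.castSucc) else 0) + F.flip t,
        ptMat pt *ᵥ v + p.2 ᵥ* C'.HX + F.readError pt)
    have hΦc : ∀ p, F.Consistent C' p.1 (Φ p) := fun p t => Syndrome.add_add_self _ _
    have hΦm : ∀ p, (Φ p).2 + F.readError pt = ptMat pt *ᵥ v + p.2 ᵥ* C'.HX := fun p => by
      rw [← vec_eq_add_iff]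
    have hΦz : ∀ p, C'.HZ *ᵥ ((Φ p).2 + F.readError pt) = 0 := fun p => by
      rw [hΦm, Matrix.mulVec_add, h.HZ_mulVec_ptMat hv, C'.HZ_mulVec_row, add_zero]
    have hΦl : ∀ p, (M * (ptMat pt)ᵀ) *ᵥ ((Φ p).2 + F.readError pt) = M *ᵥ v := fun p => by
      rw [hΦm, Matrix.mulVec_add, h.logical_mulVec_ptMat, h.logical_mulVec_row, add_zero]
    have hΦi : Function.Injective Φ := by
      intro p q hpq
      have e1 := (hΦc p).eq
      rw [hpq, ← (hΦc q).eq] at e1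
      have e2 := hΦm p
      rw [hpq, hΦm q, add_right_inj] at e2
      refine Prod.ext (Prod.ext_iff.1 e1).1 (vec_add_eq_zero.1 (h.rows_indep _ ?_))
      rw [Matrix.add_vecMul, e2, vec_add_self]
    rw [← Finset.sum_subset (s₁ := Finset.univ.image Φ),
      Finset.sum_image (fun p _ q _ hpq => hΦi hpq)]
    · rw [Finset.sum_congr rfl fun p _ => ((h1 _ _ (hΦc p) (hΦz p)).2.trans (by rw [hΦl])),
        Finset.sum_const, Finset.card_univ, Fintype.card_prod, ← Nat.cast_smul_eq_nsmul ℂ,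
        smul_smul]
      simp only [Fintype.card_fun, ZMod.card, Nat.cast_mul, Nat.cast_pow, Nat.cast_ofNat]
      have : (2 : ℂ) ^ Fintype.card TX ≠ 0 := pow_ne_zero _ two_ne_zero
      rw [show ∀ x : ℂ, x ≠ 0 → x * x * (x⁻¹ * x⁻¹) = 1 from fun x hx => by field_simp,
        one_smul]
      exact this
    · intro r hr
      obtain ⟨p, -, rfl⟩ := Finset.mem_image.1 hr
      exact Finset.mem_filter.2 ⟨Finset.mem_univ _, (h1 _ _ (hΦc p) (hΦz p)).1.trans (hΦl p)⟩
    · intro r hr hr'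
      refine h0 r ?_
      rintro ⟨⟨s, hs⟩, hm⟩
      refine hr' (Finset.mem_image.2 ?_)
      have ho := (Finset.mem_filter.1 hr).2
      rw [(h1 r s hs hm).1] at ho
      obtain ⟨a, ha⟩ := h.exact_at (r.2 + F.readError pt + ptMat pt *ᵥ v)
        (by rw [Matrix.mulVec_add, h.HZ_mulVec_ptMat hv, hm, add_zero])
        (by rw [Matrix.mulVec_add, h.logical_mulVec_ptMat, ho, vec_add_self])
      refine ⟨(s, a), Finset.mem_univ _, Prod.ext (funext fun t => ?_) ?_⟩
      · change _ + F.flip t = _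
        rw [← hs t, Syndrome.add_add_self]
      · change _ + F.readError pt = _
        rw [← ha, eq_comm, vec_eq_add_iff, add_comm (ptMat pt *ᵥ v), add_assoc, vec_add_self,
          add_zero]
  · have hz := zProj_mul_codeProj_eq_zero μ hv
    have hz' : zProj M μ * ρ * zProj M μ = 0 := by
      rw [← hρ, ← Matrix.mul_assoc, ← Matrix.mul_assoc, hz]
      simp
    rw [hz']
    refine Finset.sum_eq_zero fun r hr => ?_
    have ho := (Finset.mem_filter.1 hr).2
    by_cases hc : (∃ s, F.Consistent C' s r) ∧ C'.HZ *ᵥ (r.2 + F.readError pt) = 0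
    · obtain ⟨⟨s, hs⟩, hm⟩ := hc
      obtain ⟨e1, e2⟩ := h1 r s hs hm
      rw [e2, ← e1, ho, hz', smul_zero]
    · exact h0 r hc

/-! ### The run without faults -/

lemma Pauli.op_mul_self (P : Pauli D) : PhaseEq (P.op * P.op) 1 := by
  refine (P.op_mul_phaseEq P).trans (.of_eq ?_)
  rw [vec_add_self, vec_add_self, Pauli.op_zero]

lemma readError_noFaults (pt : A → Option D) (d : ℕ) :
    (noFaults D A TX TZ d).readError pt = 0 := by
  have h : (noFaults D A TX TZ d).totX = 0 := Finset.sum_eq_zero fun _ _ => rfl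
  have h1 : ((0 : D ⊕ A → ZMod 2) ∘ Sum.inl : D → ZMod 2) = 0 := rfl
  have h2 : ((0 : D ⊕ A → ZMod 2) ∘ Sum.inr : A → ZMod 2) = 0 := rfl
  rw [Faults.readError, h, h1, h2]
  simp [noFaults, h2]

open Classical in
theorem IsSteaneGadget.performs (h : IsSteaneGadget C C' pt M) {d : ℕ} (hd : 0 < d) :
    Performs C C' pt d M := by
  obtain ⟨d, rfl⟩ := Nat.exists_eq_succ_of_ne_zero hd.ne'
  let F := noFaults D A TX TZ (d + 1)
  let frame : Record A TX TZ (d + 1) → Pauli D := fun r =>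
    if hr : ∃ z, F.Consistent C' (C'.HX *ᵥ z) r then F.resid pt hr.choose else ⟨0, 0⟩
  refine ⟨frame, fun ρ hρ μ => ?_⟩
  rw [← sum_record h F ρ hρ (fun r => (M * (ptMat pt)ᵀ) *ᵥ r.2)
    (fun r => ((frame r).op * kraus C' pt F r) * ρ * ((frame r).op * kraus C' pt F r)ᴴ) ?_ ?_ μ]
  · refine Finset.sum_congr ?_ fun r _ => rfl
    ext r
    simp only [Finset.mem_filter, Finset.mem_univ, true_and, funext_iff]
    refine forall_congr' fun c => ?_
    have : ((M * (ptMat pt)ᵀ) *ᵥ r.2) c = ∑ a, (pt a).elim 0 (fun q => M c q) * r.2 a := by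
      simp only [Matrix.mulVec, dotProduct, Matrix.mul_apply, Matrix.transpose_apply]
      refine Finset.sum_congr rfl fun a _ => ?_
      rw [← ptMat_mulVec]
      simp only [Matrix.mulVec, dotProduct, mul_comm]
    rw [this]
  · intro r hr
    rw [conj_mul_codeProj _ _ hρ, Matrix.mul_assoc (frame r).op, kraus_mul_codeProj_eq_zero F r h hr]
    simp
  · intro r s hs hm
    obtain ⟨z, rfl⟩ := exists_mulVec_eq_of_vecMul_injective _ h.rows_indep s
    rw [show F.readError pt = 0 from readError_noFaults pt _, add_zero] at hm ⊢
    refine ⟨rfl, conj_eq_of_phaseEq _ _ hρ _ _ ?_⟩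
    have hr : ∃ z, F.Consistent C' (C'.HX *ᵥ z) r := ⟨z, hs⟩
    -- The Kraus operator is expanded with the very `z` chosen by `frame`, so the correction cancels
    -- the residual up to a sign.
    have hk := kraus_mul_codeProj F r h _ hr.choose_spec
      (by rwa [show F.readError pt = 0 from readError_noFaults pt _, add_zero])
    rw [show F.readError pt = 0 from readError_noFaults pt _, add_zero] at hk
    rw [Matrix.mul_assoc]
    refine (hk.mul_left _).trans ?_
    simp only [frame, dif_pos hr]
    rw [← Matrix.mul_assoc]
    refine ((Pauli.op_mul_self _).mul_right _).trans (.of_eq (Matrix.one_mul _))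

end

section

variable {D A : Type*} [Fintype D] [Fintype A] [DecidableEq D] [DecidableEq A]
variable {SX SZ TX TZ : Type*} [Fintype SX] [Fintype SZ] [DecidableEq SX] [DecidableEq SZ]
variable [Fintype TX] [Fintype TZ] [DecidableEq TX] [DecidableEq TZ]
variable {κ : Type*} [Fintype κ] [DecidableEq κ]

/-! ### Weights -/

lemma hammingNorm_add_le {ι : Type*} [Fintype ι] (x y : ι → ZMod 2) :
    hammingNorm (x + y) ≤ hammingNorm x + hammingNorm y := by
  have h := hammingDist_triangle x 0 y
  rw [hammingDist_zero_right, hammingDist_zero_left, hammingDist_eq_hammingNorm] at h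
  have : -x + y = x + y := by ext i; simp [CharTwo.neg_eq]
  rwa [this] at h

lemma hammingNorm_sum_le {ι τ : Type*} [Fintype ι] (s : Finset τ) (f : τ → ι → ZMod 2) :
    hammingNorm (∑ t ∈ s, f t) ≤ ∑ t ∈ s, hammingNorm (f t) :=
  Finset.le_sum_of_subadditive _ hammingNorm_zero.le hammingNorm_add_le _ _

lemma hammingNorm_sumType (x : D ⊕ A → ZMod 2) :
    hammingNorm x = hammingNorm (x ∘ Sum.inl) + hammingNorm (x ∘ Sum.inr) := by
  simp only [hammingNorm, Function.comp_apply, Finset.card_filter, Fintype.sum_sum_type]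

lemma Pauli.hammingNorm_x_le (P : Pauli D) : hammingNorm P.x ≤ P.weight :=
  Finset.card_le_card fun q hq => by
    simp only [Pauli.support, Finset.mem_filter, Finset.mem_univ, true_and] at hq ⊢
    exact Or.inl hq

lemma Pauli.hammingNorm_z_le (P : Pauli D) : hammingNorm P.z ≤ P.weight :=
  Finset.card_le_card fun q hq => by
    simp only [Pauli.support, Finset.mem_filter, Finset.mem_univ, true_and] at hq ⊢
    exact Or.inr hq

/-- Injectivity of the pairing prevents one data error from being copied to several ancilla qubits.
-/
lemma hammingNorm_ptMat_mulVec_le {pt : A → Option D}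
    (hpt : ∀ a b q, pt a = some q → pt b = some q → a = b) (v : D → ZMod 2) :
    hammingNorm (ptMat pt *ᵥ v) ≤ hammingNorm v := by
  have key : ∀ a, (ptMat pt *ᵥ v) a ≠ 0 → ∃ q, pt a = some q ∧ v q ≠ 0 := by
    intro a ha
    rw [ptMat_mulVec] at ha
    cases h : pt a with
    | none => simp [h] at ha
    | some q => exact ⟨q, rfl, by simpa [h] using ha⟩
  refine (Finset.card_le_card_of_injOn pt ?_ ?_).trans
    (Finset.card_image_le (s := Finset.univ.filter fun q => v q ≠ 0) (f := some))
  · intro a ha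
    obtain ⟨q, h1, h2⟩ := key a (by simpa using ha)
    simpa [h1] using h2
  · intro a ha b hb hab
    obtain ⟨q, h1, -⟩ := key a (by simpa using ha)
    exact hpt a b q h1 (hab ▸ h1)

lemma hammingNorm_vecMul_ptMat_le (pt : A → Option D) (v : A → ZMod 2) :
    hammingNorm (v ᵥ* ptMat pt) ≤ hammingNorm v := by
  refine le_trans (Finset.card_le_card_of_injOn
    (t := (Finset.univ.filter fun a => v a ≠ 0).image pt) some ?_
    (Option.some_injective _).injOn) Finset.card_image_le
  intro q hq
  have hq' : (v ᵥ* ptMat pt) q ≠ 0 := by simpa using hq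
  obtain ⟨a, -, ha⟩ := Finset.exists_ne_zero_of_sum_ne_zero hq'
  replace ha : v a * ptMat pt a q ≠ 0 := ha
  rw [ptMat, Matrix.of_apply] at ha
  have h1 : v a ≠ 0 := left_ne_zero_of_mul ha
  have h2 : pt a = some q := by
    by_contra h; simp [h] at ha
  simpa using ⟨a, h1, h2⟩

lemma hammingNorm_comp_inl_le (P : Pauli (D ⊕ A)) (pt : A → Option D) (x : D ⊕ A → ZMod 2)
    (hx : ∀ q, x q ≠ 0 → P.x q ≠ 0 ∨ P.z q ≠ 0) :
    hammingNorm (x ∘ Sum.inl) ≤ (P.support.image (cnotLocation pt)).card := by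
  refine Finset.card_le_card_of_injOn Sum.inl ?_ Sum.inl_injective.injOn
  intro q hq
  rw [Finset.mem_coe, Finset.mem_image]
  refine ⟨Sum.inl q, ?_, rfl⟩
  simp only [Pauli.support, Finset.mem_filter, Finset.mem_univ, true_and]
  exact hx _ (by simpa using hq)

/-- Distinct ancilla qubits lie in distinct CNOT locations because no data qubit has two partners.
-/
lemma hammingNorm_comp_inr_le {pt : A → Option D}
    (hpt : ∀ a b q, pt a = some q → pt b = some q → a = b) (P : Pauli (D ⊕ A)) :
    hammingNorm (P.x ∘ Sum.inr) ≤ (P.support.image (cnotLocation pt)).card := by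
  refine Finset.card_le_card_of_injOn (fun a => cnotLocation pt (Sum.inr a)) ?_ ?_
  · intro q hq
    rw [Finset.mem_coe, Finset.mem_image]
    refine ⟨Sum.inr q, ?_, rfl⟩
    simp only [Pauli.support, Finset.mem_filter, Finset.mem_univ, true_and]
    exact Or.inl (by simpa using hq)
  · intro a _ b _ hab
    simp only [cnotLocation] at hab
    cases ha : pt a with
    | none =>
      cases hb : pt b with
      | none => simpa [ha, hb] using hab
      | some q => simp [ha, hb] at hab
    | some q =>
      cases hb : pt b with
      | none => simp [ha, hb] at hab
      | some q' =>
        have : q = q' := by simpa [ha, hb] using hab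
        exact hpt a b q ha (this ▸ hb)

namespace Faults

variable {pt : A → Option D} {d : ℕ} (F : Faults D A TX TZ d)

lemma totX_comp {ι : Type*} (f : ι → D ⊕ A) : F.totX ∘ f = ∑ t, (F.idle t).x ∘ f := by
  ext q; simp [totX]

lemma totZ_comp {ι : Type*} (f : ι → D ⊕ A) : F.totZ ∘ f = ∑ t, (F.idle t).z ∘ f := by
  ext q; simp [totZ]

/-- An idle error on data and ancilla together contributes at most its own support: copying the data
part does not enlarge it. -/
lemma weight_readError_le (hpt : ∀ a b q, pt a = some q → pt b = some q → a = b) :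
    hammingNorm (F.readError pt) ≤ F.weight pt := by
  have h1 : hammingNorm (F.totX ∘ Sum.inr + ptMat pt *ᵥ (F.totX ∘ Sum.inl)) ≤
      ∑ t, (F.idle t).weight := by
    rw [totX_comp, totX_comp, Matrix.mulVec_sum, ← Finset.sum_add_distrib]
    refine (hammingNorm_sum_le _ _).trans (Finset.sum_le_sum fun t _ => ?_)
    refine (hammingNorm_add_le _ _).trans (le_trans ?_ (F.idle t).hammingNorm_x_le)
    rw [hammingNorm_sumType (F.idle t).x, add_comm]
    exact Nat.add_le_add_right (hammingNorm_ptMat_mulVec_le hpt _) _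
  have h2 := hammingNorm_comp_inr_le hpt F.cnot
  have h3 := hammingNorm_add_le (F.readout + F.cnot.x ∘ Sum.inr)
    (F.totX ∘ Sum.inr + ptMat pt *ᵥ (F.totX ∘ Sum.inl))
  have h4 := hammingNorm_add_le F.readout (F.cnot.x ∘ Sum.inr)
  rw [readError, weight]
  omega

lemma weight_residX_le (z : A → ZMod 2) : hammingNorm (F.resid pt z).x ≤ F.weight pt := by
  have h1 : hammingNorm (F.totX ∘ Sum.inl) ≤ ∑ t, (F.idle t).weight := by
    rw [totX_comp]
    refine (hammingNorm_sum_le _ _).trans (Finset.sum_le_sum fun t _ => ?_)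
    refine le_trans ?_ (F.idle t).hammingNorm_x_le
    rw [hammingNorm_sumType (F.idle t).x]
    exact Nat.le_add_right _ _
  have h2 := hammingNorm_comp_inl_le F.cnot pt F.cnot.x fun q hq => Or.inl hq
  have h3 := hammingNorm_add_le (F.totX ∘ Sum.inl) (F.cnot.x ∘ Sum.inl)
  rw [resid, weight]
  dsimp only
  omega

/-- The product of the `Z`-parts of the errors of the ancilla qubits before round `t`. -/
def cumZ (t : Fin d) : A → ZMod 2 :=
  ∑ t' : Fin d, if t' ≤ t then (F.idle t'.castSucc).z ∘ Sum.inr else 0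

/-- The `Z`-type error of the data qubits caused by the errors of the data qubits and by the errors
of the ancilla qubits after round `t`. -/
def lateZ (pt : A → Option D) (t : Fin d) : D → ZMod 2 :=
  F.totZ ∘ Sum.inl + F.cnot.z ∘ Sum.inl +
    (∑ t' : Fin (d + 1), if t' ≤ t.castSucc then 0 else (F.idle t').z ∘ Sum.inr) ᵥ* ptMat pt

lemma cumZ_add (t : Fin d) :
    F.cumZ t + (∑ t' : Fin (d + 1), if t' ≤ t.castSucc then 0 else (F.idle t').z ∘ Sum.inr) =
      F.totZ ∘ Sum.inr := by
  rw [totZ_comp, Fin.sum_univ_castSucc, Fin.sum_univ_castSucc, ← add_assoc, cumZ,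
    -- The idle step after the last round is later than every round `t`, so it always belongs to the
    -- second sum.
    ← Finset.sum_add_distrib, if_neg (by simp [Fin.le_def])]
  congr 1
  refine Finset.sum_congr rfl fun t' _ => ?_
  simp only [Fin.castSucc_le_castSucc_iff]
  split_ifs <;> simp

/-- The residual is cut at round `t`: what the `X`-checks of that round have seen, together with the
frame `z`, is separated from a part of bounded weight. -/
lemma resid_z (z : A → ZMod 2) (t : Fin d) :
    (F.resid pt z).z = F.lateZ pt t + (F.cumZ t + z) ᵥ* ptMat pt := by
  rw [resid, lateZ, ← F.cumZ_add t, add_comm (F.cumZ t), add_assoc _ (F.cumZ t) z,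
    Matrix.add_vecMul, ← add_assoc]

/-- Late errors and flipped `X`-outcomes are charged to different locations. Early ancilla errors
are absent from `lateZ`, so the bound needs no control of the frame. -/
lemma weight_lateZ_le (t : Fin d) :
    hammingNorm (F.lateZ pt t) + ∑ t, hammingNorm (F.flip t).1 ≤ F.weight pt := by
  have h1 : hammingNorm (F.totZ ∘ Sum.inl +
      (∑ t' : Fin (d + 1), if t' ≤ t.castSucc then 0 else (F.idle t').z ∘ Sum.inr) ᵥ* ptMat pt) ≤
      ∑ t, (F.idle t).weight := by
    rw [totZ_comp, Matrix.sum_vecMul, ← Finset.sum_add_distrib]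
    refine (hammingNorm_sum_le _ _).trans (Finset.sum_le_sum fun t' _ => ?_)
    refine (hammingNorm_add_le _ _).trans (le_trans ?_ (F.idle t').hammingNorm_z_le)
    rw [hammingNorm_sumType (F.idle t').z]
    refine Nat.add_le_add_left ((hammingNorm_vecMul_ptMat_le _ _).trans ?_) _
    split_ifs <;> simp
  have h2 := hammingNorm_comp_inl_le F.cnot pt F.cnot.z fun q hq => Or.inr hq
  have h3 := hammingNorm_add_le (F.totZ ∘ Sum.inl +
    (∑ t' : Fin (d + 1), if t' ≤ t.castSucc then 0 else (F.idle t').z ∘ Sum.inr) ᵥ* ptMat pt)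
    (F.cnot.z ∘ Sum.inl)
  rw [lateZ, weight, Finset.sum_add_distrib, add_right_comm]
  omega

lemma Consistent.fst {C' : CSS A TX TZ} {F : Faults D A TX TZ d} {s : TX → ZMod 2}
    {r : Record A TX TZ d} (h : F.Consistent C' s r) (t : Fin d) :
    (r.1 t).1 + (F.flip t).1 = s + C'.HX *ᵥ F.cumZ t := by
  have h1 := congrArg Prod.fst (h t)
  rw [Prod.fst_add, Prod.fst_add, Prod.fst_sum] at h1
  rw [h1, cumZ, Matrix.mulVec_sum]
  congr 1
  refine Finset.sum_congr rfl fun t' _ => ?_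
  split_ifs
  · simp only [CSS.synd, CSS.onAncilla]
    rw [Matrix.fromCols_mulVec, Matrix.zero_mulVec, zero_add]
  · simp

end Faults

/-! ### Decoding -/

/-- Conditions on the minimum weights of the logical operators. -/
structure HasDistances (C : CSS D SX SZ) (C' : CSS A TX TZ) (δ : ℕ) : Prop where
  ancilla_x : ∀ x, C'.HZ *ᵥ x = 0 → hammingNorm x < δ → ∃ a, x = a ᵥ* C'.HX
  data_x : ∀ x, C.HZ *ᵥ x = 0 → hammingNorm x < δ → ∃ a, x = a ᵥ* C.HX
  data_z : ∀ z, C.HX *ᵥ z = 0 → hammingNorm z < δ → ∃ a, z = a ᵥ* C.HZ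

variable {C : CSS D SX SZ} {C' : CSS A TX TZ} {pt : A → Option D} {M : Matrix κ D (ZMod 2)}

/-- Dual form of `exact_at`: a vector orthogonal to the `X`-checks is a combination of ancilla
`Z`-checks and measured operators. Pulled back to the data, the former become data `Z`-checks by
`restrict`, the latter rows of `M` by `support`. -/
lemma IsSteaneGadget.exists_vecMul_of_HX_mulVec_eq_zero (h : IsSteaneGadget C C' pt M)
    {k : A → ZMod 2} (hk : C'.HX *ᵥ k = 0) :
    ∃ b c, k ᵥ* ptMat pt = b ᵥ* C.HZ + c ᵥ* M := by
  obtain ⟨a, ha⟩ := exists_vecMul_eq_of_forall_dotProduct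
    (Matrix.fromRows C'.HZ (M * (ptMat pt)ᵀ)) k fun y hy => by
      rw [Matrix.fromRows_mulVec] at hy
      obtain ⟨a, rfl⟩ := h.exact_at y (funext fun c => congrFun hy (Sum.inl c))
        (funext fun c => congrFun hy (Sum.inr c))
      rw [dotProduct_comm, ← Matrix.dotProduct_mulVec, hk, dotProduct_zero]
  obtain ⟨R, hR⟩ := h.restrict
  refine ⟨(a ∘ Sum.inl) ᵥ* R, a ∘ Sum.inr, ?_⟩
  rw [ha, Matrix.vecMul_fromRows, Matrix.add_vecMul, Matrix.vecMul_vecMul, Matrix.vecMul_vecMul,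
    Matrix.vecMul_vecMul, hR, h.support]

lemma CSS.HX_mulVec_row (C : CSS D SX SZ) (a : SZ → ZMod 2) : C.HX *ᵥ (a ᵥ* C.HZ) = 0 := by
  rw [← Matrix.mulVec_transpose, Matrix.mulVec_mulVec, C.comm, Matrix.zero_mulVec]

/-! ### Comparison of two fault patterns with the same record -/

section

variable {d : ℕ} {F G : Faults D A TX TZ d} {r : Record A TX TZ d}

/-- The two readout errors differ by a vector of weight below `δ` satisfying the `Z`-checks, hence
by a combination of `X`-checks, on which the measured parities vanish. -/
lemma logical_readout_eq (h : IsSteaneGadget C C' pt M) {δ : ℕ} (hδ : HasDistances C C' δ)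
    (hF : 2 * F.weight pt < δ) (hG : 2 * G.weight pt < δ)
    (hFm : C'.HZ *ᵥ (r.2 + F.readError pt) = 0) (hGm : C'.HZ *ᵥ (r.2 + G.readError pt) = 0) :
    (M * (ptMat pt)ᵀ) *ᵥ (r.2 + F.readError pt) = (M * (ptMat pt)ᵀ) *ᵥ (r.2 + G.readError pt) := by
  have e : F.readError pt + G.readError pt =
      (r.2 + F.readError pt) + (r.2 + G.readError pt) := by
    rw [add_add_add_comm, vec_add_self, zero_add]
  obtain ⟨a, ha⟩ := hδ.ancilla_x (F.readError pt + G.readError pt)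
    (by rw [e, Matrix.mulVec_add, hFm, hGm, add_zero])
    (by
      have h1 := hammingNorm_add_le (F.readError pt) (G.readError pt)
      have h2 := F.weight_readError_le h.injective
      have h3 := G.weight_readError_le h.injective
      omega)
  rw [← vec_add_eq_zero, ← Matrix.mulVec_add, ← e, ha, h.logical_mulVec_row]

lemma resid_add_resid (h : IsSteaneGadget C C' pt M) (hδ : HasDistances C C' d)
    (hF : 2 * F.weight pt < d) (hG : 2 * G.weight pt < d) {y z : A → ZMod 2}
    (hFc : F.Consistent C' (C'.HX *ᵥ y) r) (hGc : G.Consistent C' (C'.HX *ᵥ z) r)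
    (hs : C.synd (F.resid pt y) = C.synd (G.resid pt z)) :
    ∃ a b c, (F.resid pt y).x + (G.resid pt z).x = a ᵥ* C.HX ∧
      (F.resid pt y).z + (G.resid pt z).z = b ᵥ* C.HZ + c ᵥ* M := by
  have hs1 := congrArg Prod.fst hs
  have hs2 := congrArg Prod.snd hs
  simp only [CSS.synd] at hs1 hs2
  obtain ⟨a, ha⟩ := hδ.data_x ((F.resid pt y).x + (G.resid pt z).x)
    (by rw [Matrix.mulVec_add, hs2, vec_add_self])
    (by
      have h1 := hammingNorm_add_le (F.resid pt y).x (G.resid pt z).x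
      have h2 := F.weight_residX_le (pt := pt) y
      have h3 := G.weight_residX_le (pt := pt) z
      omega)
  -- Otherwise each of the `d` rounds would cost at least one fault in one of the patterns, while
  -- together they have fewer than `d`.
  obtain ⟨t, ht⟩ : ∃ t : Fin d, (F.flip t).1 = 0 ∧ (G.flip t).1 = 0 := by
    by_contra! hne
    have h1 : ∀ t : Fin d, 1 ≤ hammingNorm (F.flip t).1 + hammingNorm (G.flip t).1 := by
      intro t
      by_cases hf : (F.flip t).1 = 0
      · have := hammingNorm_pos_iff.2 (hne t hf)
        omega
      · have := hammingNorm_pos_iff.2 hf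
        omega
    have h2 := Finset.sum_le_sum fun t (_ : t ∈ (Finset.univ : Finset (Fin d))) => h1 t
    rw [Finset.sum_add_distrib] at h2
    simp only [Finset.sum_const, Finset.card_univ, Fintype.card_fin, smul_eq_mul, mul_one] at h2
    have hd : 0 < d := by omega
    have h3 := F.weight_lateZ_le (pt := pt) ⟨0, hd⟩
    have h4 := G.weight_lateZ_le (pt := pt) ⟨0, hd⟩
    omega
  -- In this round both patterns explain the same unflipped outcomes, so their accumulated errors
  -- and frames have equal `X`-syndrome.
  have hk : C'.HX *ᵥ ((F.cumZ t + y) + (G.cumZ t + z)) = 0 := by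
    have h1 := hFc.fst t
    have h2 := hGc.fst t
    rw [ht.1, add_zero, ← Matrix.mulVec_add] at h1
    rw [ht.2, add_zero, ← Matrix.mulVec_add] at h2
    rw [Matrix.mulVec_add, add_comm (F.cumZ t), add_comm (G.cumZ t), ← h1, ← h2, vec_add_self]
  obtain ⟨b, c, hbc⟩ := h.exists_vecMul_of_HX_mulVec_eq_zero hk
  have e : (F.resid pt y).z + (G.resid pt z).z =
      F.lateZ pt t + G.lateZ pt t + (b ᵥ* C.HZ + c ᵥ* M) := by
    rw [← hbc, F.resid_z y t, G.resid_z z t,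
      Matrix.add_vecMul _ (F.cumZ t + y) (G.cumZ t + z)]
    abel
  -- Stabilizers and measured operators commute with the data `X`-checks, so the late parts alone
  -- inherit the equality of syndromes.
  obtain ⟨b', hb'⟩ := hδ.data_z (F.lateZ pt t + G.lateZ pt t)
    (by
      have h1 : C.HX *ᵥ ((F.resid pt y).z + (G.resid pt z).z) = 0 := by
        rw [Matrix.mulVec_add, hs1, vec_add_self]
      have h2 : C.HX *ᵥ (c ᵥ* M) = 0 := by
        rw [← Matrix.vecMul_transpose, Matrix.vecMul_vecMul, h.logical_data, Matrix.vecMul_zero]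
      rwa [e, Matrix.mulVec_add, Matrix.mulVec_add _ (b ᵥ* C.HZ), C.HX_mulVec_row, h2, add_zero,
        add_zero] at h1)
    (by
      have h1 := hammingNorm_add_le (F.lateZ pt t) (G.lateZ pt t)
      have h2 := F.weight_lateZ_le (pt := pt) t
      have h3 := G.weight_lateZ_le (pt := pt) t
      omega)
  refine ⟨a, b' + b, c, ha, ?_⟩
  rw [e, hb', Matrix.add_vecMul, add_assoc]

end

/-- On the measured code space, stabilizers act trivially and a product of measured operators acts
by a sign depending on the outcome. -/
lemma stabilizer_op_mul (h : IsSteaneGadget C C' pt M) (a : SX → ZMod 2) (b : SZ → ZMod 2)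
    (c ν : κ → ZMod 2) :
    PhaseEq ((Pauli.mk (a ᵥ* C.HX) (b ᵥ* C.HZ + c ᵥ* M)).op * (zProj M ν * C.codeProj))
      (zProj M ν * C.codeProj) := by
  have h1 : (Pauli.mk (a ᵥ* C.HX) (b ᵥ* C.HZ + c ᵥ* M)).op =
      (Pauli.mk (a ᵥ* C.HX) 0).op * (Pauli.mk 0 (b ᵥ* C.HZ + c ᵥ* M)).op := by
    rw [Pauli.op_mul]
    simp
  have h2 : (Pauli.mk 0 (b ᵥ* C.HZ + c ᵥ* M)).op * (zProj M ν * C.codeProj) =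
      sgn (c ⬝ᵥ ν) • (zProj M ν * C.codeProj) := by
    rw [← C.zProj_mul_codeProj, ← Matrix.mul_assoc, ← Matrix.mul_assoc, ← Matrix.mul_assoc,
      ← Matrix.smul_mul]
    congr 1
    rw [Pauli.op_x_zero, zProj, zProj, Matrix.diagonal_mul_diagonal, Matrix.diagonal_mul_diagonal,
      Matrix.diagonal_mul_diagonal, ← Matrix.diagonal_smul]
    congr 1
    ext v
    by_cases hv : C.HZ *ᵥ v = 0
    · by_cases hv' : M *ᵥ v = ν
      · simp [add_dotProduct, ← Matrix.dotProduct_mulVec, hv, hv']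
      · simp [hv']
    · simp [if_neg hv]
  have h3 : (Pauli.mk (a ᵥ* C.HX) 0).op * (zProj M ν * C.codeProj) = zProj M ν * C.codeProj := by
    have h4 : M *ᵥ (a ᵥ* C.HX) = 0 := by
      rw [← Matrix.mulVec_transpose, Matrix.mulVec_mulVec, h.logical_data, Matrix.zero_mulVec]
    have h5 := zProj_mul_op M ν ⟨a ᵥ* C.HX, 0⟩
    simp only [h4, add_zero] at h5
    rw [← Matrix.mul_assoc, ← h5, Matrix.mul_assoc, ← C.xProj_mul_codeProj, ← Matrix.mul_assoc _
      (xProj _ _), op_row_mul_xProj, dotProduct_zero, sgn_zero, one_smul]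
  rw [h1, Matrix.mul_assoc, h2, Matrix.mul_smul, h3]
  exact .of_sgn_smul _ _

/-- The measured operators commute with all checks, so the ideal measurement does not leave the code
space. -/
lemma synProj_mul_zProj_mul_codeProj (h : IsSteaneGadget C C' pt M) (τ : Syndrome SX SZ)
    (ν : κ → ZMod 2) :
    C.synProj τ * (zProj M ν * C.codeProj) = if τ = 0 then zProj M ν * C.codeProj else 0 := by
  have h1 : C.synProj τ * zProj M ν = zProj M ν * C.synProj τ := by
    have h2 : zProj C.HZ τ.2 * zProj M ν = zProj M ν * zProj C.HZ τ.2 := by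
      rw [zProj, zProj, Matrix.diagonal_mul_diagonal, Matrix.diagonal_mul_diagonal]
      congr 1
      ext v
      exact mul_comm _ _
    have h3 : C.HX * Mᵀ = 0 := by
      have := congrArg Matrix.transpose h.logical_data
      rwa [Matrix.transpose_mul, Matrix.transpose_transpose, Matrix.transpose_zero] at this
    rw [CSS.synProj, Matrix.mul_assoc, h2, ← Matrix.mul_assoc, ← Matrix.mul_assoc,
      zProj_mul_xProj_comm M C.HX h3]
  rw [← Matrix.mul_assoc, h1, Matrix.mul_assoc, CSS.codeProj, C.synProj_mul_synProj]
  split_ifs with hτ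
  · rw [hτ]
  · rw [Matrix.mul_zero]

open Classical in
theorem IsSteaneGadget.toleratesFaults (h : IsSteaneGadget C C' pt M) {d : ℕ} (hd : 0 < d)
    (hδ : HasDistances C C' d) : ToleratesFaults C C' pt d M d := by
  obtain ⟨d, rfl⟩ := Nat.exists_eq_succ_of_ne_zero hd.ne'
  -- The outcome decoder corrects the readout by any sufficiently light pattern that clears the
  -- `Z`-checks; the default 0 is not reached on contributing records.
  let out : Record A TX TZ (d + 1) → κ → ZMod 2 := fun r =>
    if hr : ∃ F : Faults D A TX TZ (d + 1),
        2 * F.weight pt < d + 1 ∧ C'.HZ *ᵥ (r.2 + F.readError pt) = 0 then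
      (M * (ptMat pt)ᵀ) *ᵥ (r.2 + hr.choose.readError pt) else 0
  -- A light pattern together with a frame is chosen that explains both the record and the final
  -- data syndrome, and its residual is undone.
  let recover : Record A TX TZ (d + 1) → Syndrome SX SZ → Pauli D := fun r τ =>
    if hr : ∃ p : Faults D A TX TZ (d + 1) × (A → ZMod 2), 2 * p.1.weight pt < d + 1 ∧
        p.1.Consistent C' (C'.HX *ᵥ p.2) r ∧ C.synd (p.1.resid pt p.2) = τ then
      hr.choose.1.resid pt hr.choose.2 else ⟨0, 0⟩
  refine ⟨out, recover, fun F hF ρ hρ μ => ?_⟩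
  refine sum_record h F ρ hρ out _ ?_ ?_ μ
  · intro r hr
    refine Finset.sum_eq_zero fun τ _ => ?_
    rw [conj_mul_codeProj _ _ hρ, Matrix.mul_assoc (_ * C.synProj τ),
      kraus_mul_codeProj_eq_zero F r h hr]
    simp
  · intro r s hs hm
    obtain ⟨z, rfl⟩ := exists_mulVec_eq_of_vecMul_injective _ h.rows_indep s
    constructor
    · have hr : ∃ F : Faults D A TX TZ (d + 1),
        2 * F.weight pt < d + 1 ∧ C'.HZ *ᵥ (r.2 + F.readError pt) = 0 := ⟨F, hF, hm⟩
      simp only [out, dif_pos hr]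
      exact logical_readout_eq h hδ hr.choose_spec.1 hF hr.choose_spec.2 hm
    · have hk : ∀ τ, PhaseEq (C.synProj τ * (kraus C' pt F r * C.codeProj))
          ((F.resid pt z).op * (((2 : ℂ) ^ Fintype.card TX)⁻¹ •
            if τ = C.synd (F.resid pt z) then
              zProj M ((M * (ptMat pt)ᵀ) *ᵥ (r.2 + F.readError pt)) * C.codeProj else 0)) := by
        intro τ
        refine ((kraus_mul_codeProj F r h z hs hm).mul_left _).trans (.of_eq ?_)
        rw [← Matrix.mul_assoc, C.synProj_mul_op, Matrix.mul_assoc, Matrix.mul_smul,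
          synProj_mul_zProj_mul_codeProj h]
        congr 2
        refine if_congr ?_ rfl rfl
        constructor
        · intro e
          rw [← Syndrome.add_add_self τ (C.synd (F.resid pt z)), e, zero_add]
        · rintro rfl
          have := Syndrome.add_add_self 0 (C.synd (F.resid pt z))
          rwa [zero_add] at this
      -- The state is a code state hit by the residual, so only the syndrome of the residual can
      -- occur.
      rw [Finset.sum_eq_single (C.synd (F.resid pt z))]
      · refine conj_eq_of_phaseEq _ _ hρ _ _ ?_
        have hr : ∃ p : Faults D A TX TZ (d + 1) × (A → ZMod 2), 2 * p.1.weight pt < d + 1 ∧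
            p.1.Consistent C' (C'.HX *ᵥ p.2) r ∧
            C.synd (p.1.resid pt p.2) = C.synd (F.resid pt z) := ⟨(F, z), hF, hs, rfl⟩
        have hk' := hk (C.synd (F.resid pt z))
        rw [if_pos rfl] at hk'
        rw [Matrix.mul_assoc, Matrix.mul_assoc]
        refine (hk'.mul_left _).trans ?_
        simp only [recover, dif_pos hr]
        obtain ⟨h1, h2, h3⟩ := hr.choose_spec
        obtain ⟨a, b, c, hx, hz⟩ := resid_add_resid h hδ h1 hF h2 hs h3
        rw [← Matrix.mul_assoc]
        refine ((Pauli.op_mul_phaseEq _ _).mul_right _).trans ?_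
        rw [hx, hz, Matrix.mul_smul]
        exact (stabilizer_op_mul h a b c _).smul _
      · intro τ _ hτ
        have hk' := hk τ
        rw [if_neg hτ, smul_zero, Matrix.mul_zero] at hk'
        rw [conj_mul_codeProj _ _ hρ, Matrix.mul_assoc (_ * C.synProj τ),
          Matrix.mul_assoc (recover r τ).op, hk'.eq_zero]
        simp
      · simp

end

/-! ### Hypergraph product codes -/

section HGP

variable {B1 C1 B2 C2 : Type*} [Fintype B1] [Fintype C1] [Fintype B2] [Fintype C2]
  [DecidableEq B1] [DecidableEq C1] [DecidableEq B2] [DecidableEq C2]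

lemma one_kronecker_mulVec (H : Matrix C2 B2 (ZMod 2)) (y : B1 × B2 → ZMod 2) (p : B1 × C2) :
    (((1 : Matrix B1 B1 (ZMod 2)) ⊗ₖ H) *ᵥ y) p = ∑ b, H p.2 b * y (p.1, b) := by
  simp only [Matrix.mulVec, dotProduct, Fintype.sum_prod_type, Matrix.kroneckerMap_apply]
  rw [Finset.sum_eq_single p.1]
  · simp
  · intro b _ hb
    simp [Matrix.one_apply_ne hb.symm]
  · simp

lemma kronecker_one_mulVec (H : Matrix C1 B1 (ZMod 2)) (y : B1 × B2 → ZMod 2) (p : C1 × B2) :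
    ((H ⊗ₖ (1 : Matrix B2 B2 (ZMod 2))) *ᵥ y) p = ∑ b, H p.1 b * y (b, p.2) := by
  simp only [Matrix.mulVec, dotProduct, Fintype.sum_prod_type, Matrix.kroneckerMap_apply]
  refine Finset.sum_congr rfl fun b _ => ?_
  rw [Finset.sum_eq_single p.2]
  · simp
  · intro b _ hb
    simp [Matrix.one_apply_ne hb.symm]
  · simp

/-- The part of a vector on the first block of qubits, as a matrix. -/
def blockL (x : (B1 × B2) ⊕ (C1 × C2) → ZMod 2) : Matrix B1 B2 (ZMod 2) :=
  Matrix.of fun b1 b2 => x (Sum.inl (b1, b2))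

/-- The part of a vector on the second block of qubits, as a matrix. -/
def blockR (x : (B1 × B2) ⊕ (C1 × C2) → ZMod 2) : Matrix C1 C2 (ZMod 2) :=
  Matrix.of fun c1 c2 => x (Sum.inr (c1, c2))

variable (H1 : Matrix C1 B1 (ZMod 2)) (H2 : Matrix C2 B2 (ZMod 2))

lemma HGP_HZ_mulVec (x : (B1 × B2) ⊕ (C1 × C2) → ZMod 2) (p : C1 × B2) :
    ((HGP H1 H2).HZ *ᵥ x) p = (H1 * blockL x + blockR x * H2) p.1 p.2 := by
  simp only [HGP]
  rw [Matrix.fromCols_mulVec, Pi.add_apply, kronecker_one_mulVec, one_kronecker_mulVec,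
    Matrix.add_apply, Matrix.mul_apply, Matrix.mul_apply]
  congr 1
  exact Finset.sum_congr rfl fun b _ => mul_comm _ _

lemma HGP_HX_mulVec (x : (B1 × B2) ⊕ (C1 × C2) → ZMod 2) (p : B1 × C2) :
    ((HGP H1 H2).HX *ᵥ x) p = (blockL x * H2ᵀ + H1ᵀ * blockR x) p.1 p.2 := by
  simp only [HGP]
  rw [Matrix.fromCols_mulVec, Pi.add_apply, kronecker_one_mulVec, one_kronecker_mulVec,
    Matrix.add_apply, Matrix.mul_apply, Matrix.mul_apply]
  congr 1
  exact Finset.sum_congr rfl fun b _ => mul_comm _ _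

lemma HGP_vecMul_HX (U : Matrix B1 C2 (ZMod 2)) :
    (fun p => U p.1 p.2) ᵥ* (HGP H1 H2).HX =
      Sum.elim (fun p => (U * H2) p.1 p.2) (fun p => (H1 * U) p.1 p.2) := by
  rw [← Matrix.mulVec_transpose]
  simp only [HGP]
  rw [Matrix.transpose_fromCols, Matrix.fromRows_mulVec, ← Matrix.kroneckerMap_transpose,
    ← Matrix.kroneckerMap_transpose, Matrix.transpose_one, Matrix.transpose_one,
    Matrix.transpose_transpose]
  congr 1
  · ext p
    rw [one_kronecker_mulVec, Matrix.mul_apply]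
    exact Finset.sum_congr rfl fun b _ => mul_comm _ _
  · ext p
    rw [kronecker_one_mulVec, Matrix.mul_apply]

lemma HGP_vecMul_HZ (W : Matrix C1 B2 (ZMod 2)) :
    (fun p => W p.1 p.2) ᵥ* (HGP H1 H2).HZ =
      Sum.elim (fun p => (H1ᵀ * W) p.1 p.2) (fun p => (W * H2ᵀ) p.1 p.2) := by
  rw [← Matrix.mulVec_transpose]
  simp only [HGP]
  rw [Matrix.transpose_fromCols, Matrix.fromRows_mulVec, ← Matrix.kroneckerMap_transpose,
    ← Matrix.kroneckerMap_transpose, Matrix.transpose_one, Matrix.transpose_one,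
    Matrix.transpose_transpose]
  congr 1
  · ext p
    rw [kronecker_one_mulVec, Matrix.mul_apply]
  · ext p
    rw [one_kronecker_mulVec, Matrix.mul_apply]
    exact Finset.sum_congr rfl fun b _ => mul_comm _ _

/-! ### Exactness and low-weight vectors of a hypergraph product -/

variable {H1 H2}

lemma mul_eq_zero_of_rows_indep {X : Matrix C1 C2 (ZMod 2)}
    (h2 : ∀ a, a ᵥ* H2 = 0 → a = 0) (h : X * H2 = 0) : X = 0 := by
  ext c1 c2
  refine congrFun (h2 (X c1) ?_) c2
  ext b
  exact congrFun (congrFun h c1) b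

lemma mat_add_eq_zero {m n : Type*} {X Y : Matrix m n (ZMod 2)} : X + Y = 0 ↔ X = Y := by
  constructor
  · intro h
    ext i j
    exact CharTwo.add_eq_zero.1 (congrFun (congrFun h i) j)
  · rintro rfl
    ext i j
    exact CharTwo.add_self_eq_zero _

/-- A pair of matrices in the kernel of the product checks is in the image of the other checks if
its first member vanishes on the kernel of `H2`. -/
lemma exists_factor {X : Matrix B1 B2 (ZMod 2)} {Y : Matrix C1 C2 (ZMod 2)}
    (h2 : ∀ a, a ᵥ* H2 = 0 → a = 0) (h : H1 * X + Y * H2 = 0)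
    (hk : ∀ y, H2 *ᵥ y = 0 → X *ᵥ y = 0) : ∃ U : Matrix B1 C2 (ZMod 2), X = U * H2 ∧ Y = H1 * U := by
  have : ∀ b, ∃ u, X b = u ᵥ* H2 := fun b =>
    exists_vecMul_eq_of_forall_dotProduct H2 (X b) fun y hy => congrFun (hk y hy) b
  choose U hU using this
  have hX : X = Matrix.of U * H2 := by
    ext b c
    rw [hU]
    rfl
  -- `Y` and `H1 * U` agree after right multiplication by `H2`, whose rows are independent.
  refine ⟨Matrix.of U, hX, (mat_add_eq_zero.1 (mul_eq_zero_of_rows_indep h2 ?_)).symm⟩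
  rw [Matrix.add_mul, Matrix.mul_assoc, ← hX, h]

/-- `X` maps `ker H2` into `ker H1`, and `X *ᵥ y` is supported on the nonzero rows of `X`, of which
there are too few for a nonzero codeword. -/
lemma exists_factor_of_card_lt {X : Matrix B1 B2 (ZMod 2)} {Y : Matrix C1 C2 (ZMod 2)}
    (h2 : ∀ a, a ᵥ* H2 = 0 → a = 0) (h : H1 * X + Y * H2 = 0) {δ : ℕ}
    (hd : ∀ v, H1 *ᵥ v = 0 → v ≠ 0 → δ ≤ hammingNorm v)
    (hX : (Finset.univ.filter fun p : B1 × B2 => X p.1 p.2 ≠ 0).card < δ) :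
    ∃ U : Matrix B1 C2 (ZMod 2), X = U * H2 ∧ Y = H1 * U := by
  refine exists_factor h2 h fun y hy => ?_
  by_contra hne
  refine absurd (hd (X *ᵥ y) ?_ hne) (not_le.2 (lt_of_le_of_lt ?_ hX))
  · rw [Matrix.mulVec_mulVec, mat_add_eq_zero.1 h, ← Matrix.mulVec_mulVec, hy, Matrix.mulVec_zero]
  · refine (Finset.card_le_card fun b hb => ?_).trans (Finset.card_image_le (f := Prod.fst))
    have hb' : (X *ᵥ y) b ≠ 0 := by simpa using hb
    obtain ⟨b2, -, h2⟩ := Finset.exists_ne_zero_of_sum_ne_zero hb'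
    refine Finset.mem_image.2 ⟨(b, b2), ?_, rfl⟩
    simpa using left_ne_zero_of_mul h2

lemma card_block_le (x : (B1 × B2) ⊕ (C1 × C2) → ZMod 2) :
    (Finset.univ.filter fun p : B1 × B2 => blockL x p.1 p.2 ≠ 0).card ≤ hammingNorm x := by
  refine Finset.card_le_card_of_injOn Sum.inl ?_ Sum.inl_injective.injOn
  intro p hp
  simpa [blockL] using hp

lemma eq_elim_blocks (x : (B1 × B2) ⊕ (C1 × C2) → ZMod 2) :
    x = Sum.elim (fun p => blockL x p.1 p.2) (fun p => blockR x p.1 p.2) := by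
  ext (p | p) <;> rfl

lemma HGP_exists_vecMul_HX (h2 : ∀ a, a ᵥ* H2 = 0 → a = 0) {δ : ℕ}
    (hd : ∀ v, H1 *ᵥ v = 0 → v ≠ 0 → δ ≤ hammingNorm v) (x : (B1 × B2) ⊕ (C1 × C2) → ZMod 2)
    (hx : (HGP H1 H2).HZ *ᵥ x = 0) (hw : hammingNorm x < δ) :
    ∃ a, x = a ᵥ* (HGP H1 H2).HX := by
  obtain ⟨U, hU1, hU2⟩ := exists_factor_of_card_lt (X := blockL x) (Y := blockR x) h2
    (by ext c b; rw [← HGP_HZ_mulVec H1 H2 x (c, b), hx]; rfl) hd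
    ((card_block_le x).trans_lt hw)
  refine ⟨fun p => U p.1 p.2, ?_⟩
  rw [HGP_vecMul_HX, ← hU1, ← hU2]
  exact eq_elim_blocks x

/-- Transposing both blocks exchanges the roles of the two classical matrices. -/
lemma HGP_exists_vecMul_HZ (h1 : ∀ a, a ᵥ* H1 = 0 → a = 0) {δ : ℕ}
    (hd : ∀ v, H2 *ᵥ v = 0 → v ≠ 0 → δ ≤ hammingNorm v) (x : (B1 × B2) ⊕ (C1 × C2) → ZMod 2)
    (hx : (HGP H1 H2).HX *ᵥ x = 0) (hw : hammingNorm x < δ) :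
    ∃ a, x = a ᵥ* (HGP H1 H2).HZ := by
  obtain ⟨U, hU1, hU2⟩ := exists_factor_of_card_lt (H1 := H2) (H2 := H1) (X := (blockL x)ᵀ)
    (Y := (blockR x)ᵀ) h1
    (by
      rw [← Matrix.transpose_eq_zero, Matrix.transpose_add, Matrix.transpose_mul,
        Matrix.transpose_mul, Matrix.transpose_transpose, Matrix.transpose_transpose]
      ext b c
      rw [← HGP_HX_mulVec H1 H2 x (b, c), hx]
      rfl) hd
    (by
      refine lt_of_le_of_lt ?_ ((card_block_le x).trans_lt hw)
      refine Finset.card_le_card_of_injOn Prod.swap ?_ Prod.swap_injective.injOn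
      intro p hp
      rw [Finset.mem_coe, Finset.mem_filter] at hp ⊢
      exact ⟨Finset.mem_univ _, hp.2⟩)
  refine ⟨fun p => Uᵀ p.1 p.2, ?_⟩
  have e1 : H1ᵀ * Uᵀ = blockL x := by rw [← Matrix.transpose_mul, ← hU1, Matrix.transpose_transpose]
  have e2 : Uᵀ * H2ᵀ = blockR x := by rw [← Matrix.transpose_mul, ← hU2, Matrix.transpose_transpose]
  rw [HGP_vecMul_HZ, e1, e2]
  exact eq_elim_blocks x

lemma HGP_rows_HX_indep (h2 : ∀ a, a ᵥ* H2 = 0 → a = 0) (a : B1 × C2 → ZMod 2)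
    (ha : a ᵥ* (HGP H1 H2).HX = 0) : a = 0 := by
  have h := HGP_vecMul_HX H1 H2 (Matrix.of fun b c => a (b, c))
  have h' : (Matrix.of fun b c => a (b, c)) * H2 = 0 := by
    ext b c
    exact (congrFun (h.symm.trans ha) (Sum.inl (b, c)))
  ext p
  exact congrFun (congrFun (mul_eq_zero_of_rows_indep h2 h') p.1) p.2

lemma HGP_rows_HZ_indep (h1 : ∀ a, a ᵥ* H1 = 0 → a = 0) (a : C1 × B2 → ZMod 2)
    (ha : a ᵥ* (HGP H1 H2).HZ = 0) : a = 0 := by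
  have h := HGP_vecMul_HZ H1 H2 (Matrix.of fun b c => a (b, c))
  have h' : (Matrix.of fun c b => a (b, c)) * H1 = 0 := by
    rw [← Matrix.transpose_eq_zero, Matrix.transpose_mul]
    ext b c
    exact (congrFun (h.symm.trans ha) (Sum.inl (b, c)))
  ext p
  exact congrFun (congrFun (mul_eq_zero_of_rows_indep h1 h') p.2) p.1

lemma rank_of_rows_indep {m n : Type*} [Fintype m] [Fintype n] {N : Matrix m n (ZMod 2)}
    (h : ∀ a, a ᵥ* N = 0 → a = 0) : N.rank = Fintype.card m := by
  refine LinearIndependent.rank_matrix (Matrix.vecMul_injective_iff.1 fun a b hab => ?_)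
  refine vec_add_eq_zero.1 (h _ ?_)
  rw [Matrix.add_vecMul]
  exact vec_add_eq_zero.2 hab

/-- For a CSS code the `X`- and `Z`-parts can be treated separately, each having weight at most that
of the Pauli operator. -/
lemma le_distance_of_hammingNorm {Q SX SZ : Type*} [Fintype Q] [DecidableEq Q] [Fintype SX]
    [Fintype SZ] (C : CSS Q SX SZ) (δ : ℕ)
    (hx : ∀ x, C.HZ *ᵥ x = 0 → hammingNorm x < δ → ∃ a, x = a ᵥ* C.HX)
    (hz : ∀ z, C.HX *ᵥ z = 0 → hammingNorm z < δ → ∃ a, z = a ᵥ* C.HZ) :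
    (δ : ℕ∞) ≤ C.distance := by
  refine le_iInf fun ⟨P, hP, hP'⟩ => ?_
  rw [Nat.cast_le]
  by_contra! hlt
  refine hP' ⟨?_, ?_⟩
  · obtain ⟨a, ha⟩ := hx _ hP.1 (P.hammingNorm_x_le.trans_lt hlt)
    rw [← range_vecMulLinear]
    exact ⟨a, ha.symm⟩
  · obtain ⟨a, ha⟩ := hz _ hP.2 (P.hammingNorm_z_le.trans_lt hlt)
    rw [← range_vecMulLinear]
    exact ⟨a, ha.symm⟩

end HGP

/-! ### Classical codes -/

section Classical

variable {k r : ℕ} {H : Matrix (Fin r) (Fin k ⊕ Fin r) (ZMod 2)}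

lemma mulVec_toCols {k r : ℕ} (H : Matrix (Fin r) (Fin k ⊕ Fin r) (ZMod 2))
    (v : Fin k ⊕ Fin r → ZMod 2) :
    H *ᵥ v = H.toCols₁ *ᵥ (v ∘ Sum.inl) + H.toCols₂ *ᵥ (v ∘ Sum.inr) := by
  conv_lhs => rw [← Matrix.fromCols_toCols H]
  rw [Matrix.fromCols_mulVec]

lemma eq_zero_of_info_eq_zero (hH : IsUnit H.toCols₂) {v : Fin k ⊕ Fin r → ZMod 2}
    (hv : H *ᵥ v = 0) (hi : ∀ i, v (Sum.inl i) = 0) : v = 0 := by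
  have h1 : v ∘ Sum.inl = 0 := funext hi
  rw [mulVec_toCols, h1, Matrix.mulVec_zero, zero_add] at hv
  have h2 : v ∘ Sum.inr = 0 := by
    refine Matrix.mulVec_injective_of_isUnit hH ?_
    rw [hv, Matrix.mulVec_zero]
  ext (i | i)
  · exact hi i
  · exact congrFun h2 i

lemma rows_indep_of_isUnit (hH : IsUnit H.toCols₂) (a : Fin r → ZMod 2) (ha : a ᵥ* H = 0) :
    a = 0 := by
  refine Matrix.vecMul_injective_of_isUnit hH ?_
  ext i
  change (a ᵥ* H) (Sum.inr i) = ((0 : Fin r → ZMod 2) ᵥ* H.toCols₂) i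
  rw [ha, Matrix.zero_vecMul]
  rfl

lemma mulVec_canonicalWord (hH : IsUnit H.toCols₂) (j : Fin k) : H *ᵥ canonicalWord H j = 0 := by
  rw [mulVec_toCols, canonicalWord, Sum.elim_comp_inl, Sum.elim_comp_inr, Matrix.mulVec_mulVec,
    Matrix.mul_nonsing_inv _ ((Matrix.isUnit_iff_isUnit_det _).1 hH), Matrix.one_mulVec,
    Matrix.mulVec_single_one]
  exact vec_add_self _

lemma eq_sum_canonicalWord (hH : IsUnit H.toCols₂) {v : Fin k ⊕ Fin r → ZMod 2}
    (hv : H *ᵥ v = 0) : v = ∑ j, v (Sum.inl j) • canonicalWord H j := by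
  rw [← vec_add_eq_zero]
  refine eq_zero_of_info_eq_zero hH ?_ fun i => ?_
  · rw [Matrix.mulVec_add, hv, Matrix.mulVec_sum, Finset.sum_eq_zero, add_zero]
    intro j _
    rw [Matrix.mulVec_smul, mulVec_canonicalWord hH, smul_zero]
  · simp [canonicalWord, Pi.single_apply, Finset.sum_apply, CharTwo.add_self_eq_zero]

lemma IsMinDist.le {C B : Type*} [Fintype B] {H : Matrix C B (ZMod 2)} {d : ℕ}
    (hd : IsMinDist H d) {v : B → ZMod 2} (hv : H *ᵥ v = 0) (h0 : v ≠ 0) : d ≤ hammingNorm v :=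
  hd.2 ⟨v, h0, hv, rfl⟩

lemma IsMinDist.pos {C B : Type*} [Fintype B] {H : Matrix C B (ZMod 2)} {d : ℕ}
    (hd : IsMinDist H d) : 0 < d := by
  obtain ⟨v, h0, -, rfl⟩ := hd.1
  exact hammingNorm_pos_iff.2 h0

end Classical

/-! ### Punctured codes -/

section Puncture

variable {C B : Type*} [Fintype B] [DecidableEq B] (H : Matrix C B (ZMod 2)) (S : Finset B)

/-- Extension of a vector by zero to the punctured bits. -/
def extendZero (y : {b // b ∉ S} → ZMod 2) : B → ZMod 2 :=
  fun b => if h : b ∉ S then y ⟨b, h⟩ else 0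

lemma extendZero_val (y : {b // b ∉ S} → ZMod 2) (b : {b // b ∉ S}) :
    extendZero S y b.1 = y b := by
  rw [extendZero, dif_pos b.2]

lemma extendZero_of_mem (y : {b // b ∉ S} → ZMod 2) {b : B} (hb : b ∈ S) :
    extendZero S y b = 0 := by
  rw [extendZero, dif_neg (not_not.2 hb)]

lemma extendZero_comp_val {w : B → ZMod 2} (hw : ∀ b ∈ S, w b = 0) :
    extendZero S (fun b => w b.1) = w := by
  ext b
  by_cases hb : b ∈ S
  · rw [extendZero_of_mem S _ hb, hw b hb]
  · rw [extendZero, dif_pos hb]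

lemma dotProduct_extendZero (w : B → ZMod 2) (y : {b // b ∉ S} → ZMod 2) :
    (fun b : {b // b ∉ S} => w b.1) ⬝ᵥ y = w ⬝ᵥ extendZero S y := by
  have h : ∑ b, w b * extendZero S y b = ∑ b with b ∉ S, w b * extendZero S y b := by
    refine (Finset.sum_filter_of_ne fun b _ hb => ?_).symm
    exact fun hbS => hb (by rw [extendZero_of_mem S y hbS, mul_zero])
  simp only [dotProduct]
  rw [h, Finset.sum_subtype (p := fun b => b ∉ S) _ (by simp)]
  exact Finset.sum_congr rfl fun b _ => by rw [extendZero_val]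

/-- Deleting columns of a check matrix shortens the code: its words are the codewords vanishing on
`S`, so distances cannot drop. -/
lemma puncture_mulVec (y : {b // b ∉ S} → ZMod 2) :
    puncture H S *ᵥ y = H *ᵥ extendZero S y := by
  ext c
  exact dotProduct_extendZero S (H c) y

lemma hammingNorm_extendZero (y : {b // b ∉ S} → ZMod 2) :
    hammingNorm (extendZero S y) ≤ hammingNorm y := by
  refine (Finset.card_le_card fun b hb => ?_).trans (Finset.card_image_le (f := Subtype.val))
  have hb' : extendZero S y b ≠ 0 := by simpa using hb
  have hS : b ∉ S := fun h => hb' (extendZero_of_mem S y h)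
  refine Finset.mem_image.2 ⟨⟨b, hS⟩, ?_, rfl⟩
  rw [Finset.mem_filter, ← extendZero_val S y]
  exact ⟨Finset.mem_univ _, hb'⟩

end Puncture

/-! ### The horizontal check matrix of the ancilla code -/

section AncillaMatrix

variable {k2 r2 : ℕ} (H2 : Matrix (Fin r2) (Fin k2 ⊕ Fin r2) (ZMod 2))
  (E : Finset (Finset (Fin k2)))

/-- The word `∑_{j ∈ e} b_j`. -/
def edgeWord (e : Finset (Fin k2)) : Fin k2 ⊕ Fin r2 → ZMod 2 := ∑ j ∈ e, canonicalWord H2 j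

lemma edgeWord_inl (e : Finset (Fin k2)) (j : Fin k2) :
    edgeWord H2 e (Sum.inl j) = if j ∈ e then 1 else 0 := by
  simp [edgeWord, canonicalWord, Finset.sum_apply, Pi.single_apply]

variable {H2 E}

lemma inr_notMem_puncturedBits (c : Fin r2) : Sum.inr c ∉ puncturedBits r2 E := by
  simp [puncturedBits]

lemma inl_mem_puncturedBits {j : Fin k2} :
    Sum.inl j ∈ puncturedBits r2 E ↔ ∀ e ∈ E, j ∉ e := by
  simp [puncturedBits]

lemma edgeWord_of_mem_puncturedBits {e : Finset (Fin k2)} (he : e ∈ E) {b : Fin k2 ⊕ Fin r2}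
    (hb : b ∈ puncturedBits r2 E) : edgeWord H2 e b = 0 := by
  cases b with
  | inl j => rw [edgeWord_inl, if_neg (inl_mem_puncturedBits.1 hb e he)]
  | inr c => exact absurd hb (inr_notMem_puncturedBits c)

lemma mulVec_edgeWord (hH2 : IsUnit H2.toCols₂) (e : Finset (Fin k2)) :
    H2 *ᵥ edgeWord H2 e = 0 := by
  rw [edgeWord, Matrix.mulVec_sum]
  exact Finset.sum_eq_zero fun j _ => mulVec_canonicalWord hH2 j

lemma repMatrix_mulVec (v : Fin k2 ⊕ Fin r2 → ZMod 2) (c : RepCheck E) :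
    (repMatrix r2 E *ᵥ v) c =
      v (Sum.inl (c.1.1.orderEmbOfFin rfl ⟨c.2.1, by have := c.2.2; omega⟩)) +
      v (Sum.inl (c.1.1.orderEmbOfFin rfl ⟨c.2.1 + 1, by have := c.2.2; omega⟩)) := by
  change (Pi.single _ _ + Pi.single _ _) ⬝ᵥ v = _
  rw [add_dotProduct, single_one_dotProduct, single_one_dotProduct]

lemma ancillaH2_mulVec (y : {b : Fin k2 ⊕ Fin r2 // b ∉ puncturedBits r2 E} → ZMod 2) :
    ancillaH2 H2 E *ᵥ y = Sum.elim (H2 *ᵥ extendZero _ y) (repMatrix r2 E *ᵥ extendZero _ y) := by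
  rw [ancillaH2, puncture_mulVec, augment, Matrix.fromRows_mulVec]

lemma mem_iff_of_pairwiseDisjoint (hdisj : (E : Set (Finset (Fin k2))).PairwiseDisjoint id)
    {e e' : Finset (Fin k2)} (he : e ∈ E) (he' : e' ∈ E) {j : Fin k2} (hj : j ∈ e') :
    j ∈ e ↔ e' = e := by
  constructor
  · intro h
    by_contra hne
    exact Finset.disjoint_left.1 (hdisj he' he hne) hj h
  · rintro rfl
    exact hj

lemma ancillaH2_mulVec_edgeWord (hH2 : IsUnit H2.toCols₂)
    (hdisj : (E : Set (Finset (Fin k2))).PairwiseDisjoint id) {e : Finset (Fin k2)} (he : e ∈ E) :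
    ancillaH2 H2 E *ᵥ (fun b => edgeWord H2 e b.1) = 0 := by
  rw [ancillaH2_mulVec, extendZero_comp_val _ fun b hb => edgeWord_of_mem_puncturedBits he hb,
    mulVec_edgeWord hH2]
  ext (c | c)
  · rfl
  · simp only [Sum.elim_inr, repMatrix_mulVec, edgeWord_inl]
    rw [if_congr (mem_iff_of_pairwiseDisjoint hdisj he c.1.2 (Finset.orderEmbOfFin_mem _ _ _)) rfl
      rfl, if_congr (mem_iff_of_pairwiseDisjoint hdisj he c.1.2 (Finset.orderEmbOfFin_mem _ _ _))
      rfl rfl]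
    exact CharTwo.add_self_eq_zero _

lemma const_of_repMatrix_mulVec_eq_zero {v : Fin k2 ⊕ Fin r2 → ZMod 2}
    (hv : repMatrix r2 E *ᵥ v = 0) {e : Finset (Fin k2)} (he : e ∈ E) :
    ∃ t, ∀ j ∈ e, v (Sum.inl j) = t := by
  by_cases h0 : 0 < e.card
  · refine ⟨v (Sum.inl (e.orderEmbOfFin rfl ⟨0, h0⟩)), ?_⟩
    have key : ∀ n (hn : n < e.card), v (Sum.inl (e.orderEmbOfFin rfl ⟨n, hn⟩)) =
        v (Sum.inl (e.orderEmbOfFin rfl ⟨0, h0⟩)) := by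
      intro n
      induction n with
      | zero => intro _; rfl
      | succ n ih =>
        intro hn
        -- The check with index `n` compares positions `n` and `n + 1`, so it exists exactly when `n
        -- + 1 < e.card`.
        have h1 := congrFun hv ⟨⟨e, he⟩, ⟨n, Nat.lt_sub_of_add_lt hn⟩⟩
        rw [repMatrix_mulVec] at h1
        rw [← ih (by omega)]
        exact (CharTwo.add_eq_zero.1 h1).symm
    intro j hj
    have hj' : j ∈ Set.range (e.orderEmbOfFin rfl) := by rwa [Finset.range_orderEmbOfFin]
    obtain ⟨n, rfl⟩ := hj'
    exact key n.1 n.2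
  · exact ⟨0, fun j hj => absurd (Finset.card_pos.2 ⟨j, hj⟩) h0⟩

/-- A codeword is determined by its information bits. These vanish outside the hyperedges and are
constant on each one, by the appended checks. -/
lemma exists_eq_sum_edgeWord (hH2 : IsUnit H2.toCols₂)
    (hdisj : (E : Set (Finset (Fin k2))).PairwiseDisjoint id)
    {y : {b : Fin k2 ⊕ Fin r2 // b ∉ puncturedBits r2 E} → ZMod 2}
    (hy : ancillaH2 H2 E *ᵥ y = 0) :
    ∃ t : Finset (Fin k2) → ZMod 2, y = ∑ e ∈ E, t e • fun b => edgeWord H2 e b.1 := by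
  rw [ancillaH2_mulVec] at hy
  have h1 : H2 *ᵥ extendZero _ y = 0 := funext fun c => congrFun hy (Sum.inl c)
  have h2 : repMatrix r2 E *ᵥ extendZero _ y = 0 := funext fun c => congrFun hy (Sum.inr c)
  have h3 : ∀ e, ∃ t, e ∈ E → ∀ j ∈ e, extendZero _ y (Sum.inl j) = t := fun e => by
    by_cases he : e ∈ E
    · obtain ⟨t, ht⟩ := const_of_repMatrix_mulVec_eq_zero h2 he
      exact ⟨t, fun _ => ht⟩
    · exact ⟨0, fun h => absurd h he⟩
  choose t ht using h3
  refine ⟨t, ?_⟩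
  have h4 : extendZero _ y = ∑ e ∈ E, t e • edgeWord H2 e := by
    rw [eq_sum_canonicalWord hH2 h1, ← Finset.sum_subset (Finset.subset_univ (E.biUnion id)),
      Finset.sum_biUnion hdisj]
    · refine Finset.sum_congr rfl fun e he => ?_
      rw [edgeWord, Finset.smul_sum]
      exact Finset.sum_congr rfl fun j hj => by rw [ht e he j hj]
    · intro j _ hj
      rw [extendZero_of_mem, zero_smul]
      rw [inl_mem_puncturedBits]
      intro e he hje
      exact hj (Finset.mem_biUnion.2 ⟨e, he, hje⟩)
  ext b
  rw [← extendZero_val _ y b, h4]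
  simp [Finset.sum_apply]

lemma repMatrix_rows_indep (hdisj : (E : Set (Finset (Fin k2))).PairwiseDisjoint id)
    (a : RepCheck E → ZMod 2)
    (ha : ∀ y : {b : Fin k2 ⊕ Fin r2 // b ∉ puncturedBits r2 E} → ZMod 2,
      a ⬝ᵥ (repMatrix r2 E *ᵥ extendZero _ y) = 0) : a = 0 := by
  ext c
  -- Indicator of the initial segment of the hyperedge ending at the position of `c`; among all
  -- repetition checks only `c` straddles its boundary.
  let w : Fin k2 ⊕ Fin r2 → ZMod 2 := Sum.elim (fun j => if j ∈ c.1.1 ∧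
    j ≤ c.1.1.orderEmbOfFin rfl ⟨c.2.1, by have := c.2.2; omega⟩ then 1 else 0) 0
  have hw : ∀ b ∈ puncturedBits r2 E, w b = 0 := by
    rintro (j | j) hb
    · exact if_neg fun h => inl_mem_puncturedBits.1 hb _ c.1.2 h.1
    · rfl
  have h1 := ha fun b => w b.1
  rw [extendZero_comp_val _ hw] at h1
  have h2 : repMatrix r2 E *ᵥ w = Pi.single c 1 := by
    ext c'
    rw [repMatrix_mulVec]
    obtain ⟨⟨e, he⟩, n⟩ := c
    obtain ⟨⟨e', he'⟩, n'⟩ := c'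
    by_cases hee : e' = e
    · subst hee
      simp only [w, Sum.elim_inl, Finset.orderEmbOfFin_mem, true_and, OrderEmbedding.le_iff_le,
        Fin.mk_le_mk]
      by_cases hn : n' = n
      · subst hn
        simp
      · have hn' : n'.1 ≠ n.1 := fun h => hn (Fin.ext h)
        rw [Pi.single_eq_of_ne (by simpa using hn)]
        by_cases hlt : n'.1 ≤ n.1
        · rw [if_pos hlt, if_pos (by omega)]
          exact CharTwo.add_self_eq_zero _
        · rw [if_neg hlt, if_neg (by omega), add_zero]
    · rw [Pi.single_eq_of_ne (by simp [hee])]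
      have hne : ∀ j ∈ e', j ∉ e := fun j hj h =>
        hee ((mem_iff_of_pairwiseDisjoint hdisj he he' hj).1 h)
      simp only [w, Sum.elim_inl]
      rw [if_neg (fun h => hne _ (Finset.orderEmbOfFin_mem _ _ _) h.1),
        if_neg (fun h => hne _ (Finset.orderEmbOfFin_mem _ _ _) h.1), add_zero]
  rw [h2] at h1
  simpa using h1

/-- The last `r2` columns survive the deletion and meet no repetition check, so invertibility kills
the coefficients of `H2`; then the repetition checks are independent by themselves. -/
lemma ancillaH2_rows_indep (hH2 : IsUnit H2.toCols₂)
    (hdisj : (E : Set (Finset (Fin k2))).PairwiseDisjoint id)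
    (a : Fin r2 ⊕ RepCheck E → ZMod 2) (ha : a ᵥ* ancillaH2 H2 E = 0) : a = 0 := by
  have h1 : ∀ y : {b : Fin k2 ⊕ Fin r2 // b ∉ puncturedBits r2 E} → ZMod 2,
      (a ∘ Sum.inl) ⬝ᵥ (H2 *ᵥ extendZero _ y) +
        (a ∘ Sum.inr) ⬝ᵥ (repMatrix r2 E *ᵥ extendZero _ y) = 0 := fun y => by
    have : a ⬝ᵥ (ancillaH2 H2 E *ᵥ y) = 0 := by
      rw [Matrix.dotProduct_mulVec, ha, zero_dotProduct]
    rwa [ancillaH2_mulVec, dotProduct_sum, Sum.elim_comp_inl, Sum.elim_comp_inr] at this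
  have h2 : a ∘ Sum.inl = 0 := by
    refine Matrix.vecMul_injective_of_isUnit hH2 (funext fun i => ?_)
    have h3 := congrFun ha ⟨Sum.inr i, inr_notMem_puncturedBits i⟩
    rw [Matrix.vecMul, dotProduct, Fintype.sum_sum_type] at h3
    refine (Eq.trans ?_ h3).trans (congrFun (Matrix.zero_vecMul H2.toCols₂) i).symm
    rw [Finset.sum_eq_zero (s := (Finset.univ : Finset (RepCheck E))), add_zero]
    · rfl
    · intro c _
      have : ancillaH2 H2 E (Sum.inr c) ⟨Sum.inr i, inr_notMem_puncturedBits i⟩ = 0 := by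
        simp [ancillaH2, puncture, augment, repMatrix]
      exact (congrArg (_ * ·) this).trans (mul_zero _)
  have h3 : a ∘ Sum.inr = 0 := repMatrix_rows_indep hdisj _ fun y => by
    have := h1 y
    rwa [h2, zero_dotProduct, zero_add] at this
  ext (c | c)
  · exact congrFun h2 c
  · exact congrFun h3 c

lemma ancillaH2_hammingNorm_ge {d : ℕ} (hd : IsMinDist H2 d)
    (y : {b : Fin k2 ⊕ Fin r2 // b ∉ puncturedBits r2 E} → ZMod 2)
    (hy : ancillaH2 H2 E *ᵥ y = 0) (h0 : y ≠ 0) : d ≤ hammingNorm y := by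
  refine (hd.le (v := extendZero _ y) ?_ ?_).trans (hammingNorm_extendZero _ y)
  · rw [ancillaH2_mulVec] at hy
    exact funext fun c => congrFun hy (Sum.inl c)
  · intro h
    refine h0 (funext fun b => ?_)
    rw [← extendZero_val _ y b, h]
    rfl

lemma card_columns_ancillaH2 (hdisj : (E : Set (Finset (Fin k2))).PairwiseDisjoint id)
    (hne : ∅ ∉ E) :
    Fintype.card {b : Fin k2 ⊕ Fin r2 // b ∉ puncturedBits r2 E} =
      Fintype.card (Fin r2 ⊕ RepCheck E) + E.card := by
  have h1 : (E.biUnion id).card = ∑ e ∈ E, e.card := Finset.card_biUnion hdisj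
  have h2 : (E.biUnion id).card ≤ k2 := by
    simpa using Finset.card_le_univ (E.biUnion id)
  have h3 : Fintype.card (RepCheck E) + E.card = ∑ e ∈ E, e.card := by
    rw [Fintype.card_sigma]
    simp only [Fintype.card_fin]
    rw [Finset.sum_coe_sort E fun e => e.card - 1, Finset.card_eq_sum_ones, ← Finset.sum_add_distrib]
    -- Truncated subtraction: `e.card - 1 + 1 = e.card` uses that hyperedges are nonempty.
    refine Finset.sum_congr rfl fun e he => Nat.sub_add_cancel ?_
    refine Finset.card_pos.2 (Finset.nonempty_iff_ne_empty.2 ?_)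
    rintro rfl
    exact hne he
  rw [Fintype.card_subtype_compl, Fintype.card_coe, puncturedBits, Finset.card_map,
    Finset.card_sdiff_of_subset (Finset.subset_univ _), Fintype.card_sum, Fintype.card_sum]
  simp only [Finset.card_univ, Fintype.card_fin]
  omega

end AncillaMatrix

/-! ### The gadget -/

section Gadget

variable {k1 r1 k2 r2 : ℕ} {H1 : Matrix (Fin r1) (Fin k1 ⊕ Fin r1) (ZMod 2)}
  {H2 : Matrix (Fin r2) (Fin k2 ⊕ Fin r2) (ZMod 2)} {E : Finset (Finset (Fin k2))}

lemma partner_injective (a b : ((Fin k1 ⊕ Fin r1) ×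
      {b : Fin k2 ⊕ Fin r2 // b ∉ puncturedBits r2 E}) ⊕ (Fin r1 × (Fin r2 ⊕ RepCheck E)))
    (q : ((Fin k1 ⊕ Fin r1) × (Fin k2 ⊕ Fin r2)) ⊕ (Fin r1 × Fin r2))
    (ha : partner E a = some q) (hb : partner E b = some q) : a = b := by
  have h := ha.trans hb.symm
  rcases a with ⟨a1, a2⟩ | ⟨a1, a2 | a2⟩ <;> rcases b with ⟨b1, b2⟩ | ⟨b1, b2 | b2⟩ <;>
    simp only [partner, Option.some.injEq, Sum.inl.injEq, Sum.inr.injEq, Prod.mk.injEq,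
      reduceCtorEq] at h ha hb ⊢
  · exact ⟨h.1, Subtype.ext h.2⟩
  · exact h

lemma blockL_ptMat_mulVec
    (v : ((Fin k1 ⊕ Fin r1) × (Fin k2 ⊕ Fin r2)) ⊕ (Fin r1 × Fin r2) → ZMod 2)
    (b1 : Fin k1 ⊕ Fin r1) (b2 : {b : Fin k2 ⊕ Fin r2 // b ∉ puncturedBits r2 E}) :
    blockL (ptMat (partner (k1 := k1) (r1 := r1) (r2 := r2) E) *ᵥ v) b1 b2 = blockL v b1 b2.1 :=
  ptMat_mulVec _ _ _

lemma blockR_ptMat_mulVec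
    (v : ((Fin k1 ⊕ Fin r1) × (Fin k2 ⊕ Fin r2)) ⊕ (Fin r1 × Fin r2) → ZMod 2) (c1 : Fin r1)
    (c2 : Fin r2 ⊕ RepCheck E) :
    blockR (ptMat (partner (k1 := k1) (r1 := r1) (r2 := r2) E) *ᵥ v) c1 c2 = Sum.elim (blockR v c1) 0 c2 := by
  refine (ptMat_mulVec _ _ _).trans ?_
  rcases c2 with c2 | c2 <;> rfl

/-- `R` selects the data `Z`-checks at the surviving columns. The appended qubits have no partner
and see no copied data, so these checks restrict without change. -/
lemma HZ_mul_ptMat : ∃ R : Matrix (Fin r1 × {b : Fin k2 ⊕ Fin r2 // b ∉ puncturedBits r2 E})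
    (Fin r1 × (Fin k2 ⊕ Fin r2)) (ZMod 2), (HGP H1 (ancillaH2 H2 E)).HZ * ptMat (partner (k1 := k1) (r1 := r1) (r2 := r2) E) =
    R * (HGP H1 H2).HZ := by
  let ι : Fin r1 × {b : Fin k2 ⊕ Fin r2 // b ∉ puncturedBits r2 E} → Fin r1 × (Fin k2 ⊕ Fin r2) :=
    fun p => (p.1, p.2.1)
  refine ⟨(1 : Matrix _ _ (ZMod 2)).submatrix ι id, ?_⟩
  refine Matrix.ext_of_mulVec_single fun q => ?_
  rw [← Matrix.mulVec_mulVec, ← Matrix.mulVec_mulVec]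
  set v := Pi.single (M := fun _ => ZMod 2) q 1
  ext p
  have h1 : ((1 : Matrix _ _ (ZMod 2)).submatrix ι id *ᵥ ((HGP H1 H2).HZ *ᵥ v)) p =
      ((HGP H1 H2).HZ *ᵥ v) (ι p) :=
    congrFun (Matrix.one_mulVec ((HGP H1 H2).HZ *ᵥ v)) (ι p)
  rw [h1, HGP_HZ_mulVec, HGP_HZ_mulVec, Matrix.add_apply, Matrix.add_apply, Matrix.mul_apply,
    Matrix.mul_apply, Matrix.mul_apply, Matrix.mul_apply, Fintype.sum_sum_type (α₁ := Fin r2)]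
  simp only [blockL_ptMat_mulVec, blockR_ptMat_mulVec, Sum.elim_inl, Sum.elim_inr, Pi.zero_apply,
    zero_mul, Finset.sum_const_zero, add_zero]
  rfl

lemma ppm_apply (p : Fin k1 × E) :
    ppm (k1 := k1) r1 H2 E p = Sum.elim (fun q => (Pi.single (Sum.inl p.1) 1 : Fin k1 ⊕ Fin r1 → ZMod 2) q.1 *
      edgeWord H2 p.2.1 q.2) 0 := by
  change (∑ j ∈ p.2.1, logicalZ H2 p.1 j) = _
  ext (q | q)
  · simp [logicalZ, Finset.sum_apply, edgeWord, Finset.mul_sum]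
  · simp [logicalZ, Finset.sum_apply]

/-- The Pauli products to be measured, restricted to the ancilla qubits. -/
lemma ppm_mul_transpose_apply (p : Fin k1 × E) :
    (ppm (k1 := k1) r1 H2 E * (ptMat (partner (k1 := k1) (r1 := r1) (r2 := r2) E))ᵀ) p = Sum.elim
      (fun q => (Pi.single (Sum.inl p.1) 1 : Fin k1 ⊕ Fin r1 → ZMod 2) q.1 *
        edgeWord H2 p.2.1 q.2.1) 0 := by
  have h1 : (ppm (k1 := k1) r1 H2 E * (ptMat (partner (k1 := k1) (r1 := r1) (r2 := r2) E))ᵀ) p = ptMat (partner (k1 := k1) (r1 := r1) (r2 := r2) E) *ᵥ ppm (k1 := k1) r1 H2 E p := by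
    rw [← Matrix.vecMul_transpose]
    rfl
  rw [h1, ppm_apply]
  ext (q | ⟨c1, c2 | c2⟩) <;> rw [ptMat_mulVec] <;> rfl

lemma ppm_transpose_mulVec (p : Fin k1 × E)
    (x : ((Fin k1 ⊕ Fin r1) × {b : Fin k2 ⊕ Fin r2 // b ∉ puncturedBits r2 E}) ⊕
      (Fin r1 × (Fin r2 ⊕ RepCheck E)) → ZMod 2) :
    ((ppm (k1 := k1) r1 H2 E * (ptMat (partner (k1 := k1) (r1 := r1) (r2 := r2) E))ᵀ) *ᵥ x) p =
      (blockL x *ᵥ fun b => edgeWord H2 p.2.1 b.1) (Sum.inl p.1) := by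
  rw [Matrix.mulVec, ppm_mul_transpose_apply, dotProduct_sum, Sum.elim_comp_inl, Sum.elim_comp_inr,
    zero_dotProduct, add_zero, dotProduct, Fintype.sum_prod_type,
    Finset.sum_eq_single (Sum.inl p.1)]
  · simp only [Pi.single_eq_same, one_mul, Matrix.mulVec, dotProduct]
    exact Finset.sum_congr rfl fun b _ => mul_comm _ _
  · intro b _ hb
    simp [Pi.single_eq_of_ne hb]
  · simp

lemma HGP_HX_mulVec_elim {B1 C1 B2 C2 : Type*} [Fintype B1] [Fintype C1] [Fintype B2] [Fintype C2]
    [DecidableEq B1] [DecidableEq C1] [DecidableEq B2] [DecidableEq C2]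
    (H1 : Matrix C1 B1 (ZMod 2)) (H2 : Matrix C2 B2 (ZMod 2)) (u : B1 → ZMod 2) (w : B2 → ZMod 2)
    (hw : H2 *ᵥ w = 0) :
    (HGP H1 H2).HX *ᵥ (Sum.elim (fun q => u q.1 * w q.2) 0) = 0 := by
  ext p
  have h1 : blockR (Sum.elim (fun q : B1 × B2 => u q.1 * w q.2) (0 : C1 × C2 → ZMod 2)) = 0 := rfl
  have h2 : blockL (Sum.elim (fun q : B1 × B2 => u q.1 * w q.2) (0 : C1 × C2 → ZMod 2)) =
      Matrix.vecMulVec u w := rfl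
  rw [HGP_HX_mulVec, h1, h2, Matrix.mul_zero, add_zero, Matrix.vecMulVec_mul,
    Matrix.vecMul_transpose, hw]
  simp [Matrix.vecMulVec_apply]

/-- No support is lost by restricting to paired qubits, because the words of hyperedges vanish on
the deleted columns. -/
lemma ppm_mul_transpose_mul (p : Fin k1 × E) :
    (ppm (k1 := k1) r1 H2 E * (ptMat (partner (k1 := k1) (r1 := r1) (r2 := r2) E))ᵀ * ptMat (partner (k1 := k1) (r1 := r1) (r2 := r2) E)) p = ppm (k1 := k1) r1 H2 E p := by
  have h1 : (ppm (k1 := k1) r1 H2 E * (ptMat (partner (k1 := k1) (r1 := r1) (r2 := r2) E))ᵀ * ptMat (partner (k1 := k1) (r1 := r1) (r2 := r2) E)) p =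
      ((ppm (k1 := k1) r1 H2 E * (ptMat (partner (k1 := k1) (r1 := r1) (r2 := r2) E))ᵀ) p) ᵥ* ptMat (partner (k1 := k1) (r1 := r1) (r2 := r2) E) := rfl
  rw [h1, ppm_mul_transpose_apply]
  ext (⟨b1, b2⟩ | ⟨c1, c2⟩)
  · rw [ppm_apply]
    by_cases hb : b2 ∈ puncturedBits r2 E
    · rw [Sum.elim_inl, edgeWord_of_mem_puncturedBits p.2.2 hb, mul_zero]
      refine Finset.sum_eq_zero fun a _ => ?_
      rcases a with ⟨a1, a2⟩ | a
      · have : ¬ (a1 = b1 ∧ a2.1 = b2) := fun h => a2.2 (h.2 ▸ hb)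
        simp [ptMat, partner, this]
      · simp
    · refine (Finset.sum_eq_single (Sum.inl (b1, ⟨b2, hb⟩)) ?_ (by simp)).trans ?_
      · intro a _ ha
        have h0 : ptMat (partner (k1 := k1) (r1 := r1) (r2 := r2) E) a (Sum.inl (b1, b2)) = 0 :=
          if_neg fun h => ha (partner_injective a _ _ h rfl)
        exact (congrArg (_ * ·) h0).trans (mul_zero _)
      · simp [ptMat, partner]
  · rw [ppm_apply]
    refine Finset.sum_eq_zero fun a _ => ?_
    rcases a with ⟨a1, a2⟩ | a
    · simp [ptMat, partner]
    · simp

theorem isSteaneGadget (hH1 : IsUnit H1.toCols₂) (hH2 : IsUnit H2.toCols₂)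
    (hdisj : (E : Set (Finset (Fin k2))).PairwiseDisjoint id) :
    IsSteaneGadget (HGP H1 H2) (HGP H1 (ancillaH2 H2 E)) (partner E) (ppm (k1 := k1) r1 H2 E) where
  injective := partner_injective
  rows_indep := HGP_rows_HX_indep (ancillaH2_rows_indep hH2 hdisj)
  restrict := HZ_mul_ptMat
  exact_at x hx hl := by
    have hf : H1 * blockL x + blockR x * ancillaH2 H2 E = 0 := by
      ext c b
      rw [← HGP_HZ_mulVec H1 (ancillaH2 H2 E) x (c, b), hx]
      rfl
    -- The image is a codeword of `H1` whose information bits are the measured parities, so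
    -- vanishing parities make it zero.
    have hw : ∀ e ∈ E, blockL x *ᵥ (fun b => edgeWord H2 e b.1) = 0 := by
      intro e he
      refine eq_zero_of_info_eq_zero hH1 ?_ fun i => ?_
      · rw [Matrix.mulVec_mulVec, mat_add_eq_zero.1 hf, ← Matrix.mulVec_mulVec,
          ancillaH2_mulVec_edgeWord hH2 hdisj he, Matrix.mulVec_zero]
      · rw [← ppm_transpose_mulVec (i, ⟨e, he⟩) x, hl]
        rfl
    obtain ⟨U, hU1, hU2⟩ := exists_factor (ancillaH2_rows_indep hH2 hdisj) hf fun y hy => by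
      obtain ⟨t, rfl⟩ := exists_eq_sum_edgeWord hH2 hdisj hy
      rw [Matrix.mulVec_sum]
      refine Finset.sum_eq_zero fun e he => ?_
      rw [Matrix.mulVec_smul, hw e he, smul_zero]
    refine ⟨fun p => U p.1 p.2, ?_⟩
    rw [HGP_vecMul_HX, ← hU1, ← hU2]
    exact eq_elim_blocks x
  logical_ancilla := by
    ext p c
    refine (congrFun (Matrix.vecMul_transpose (HGP H1 (ancillaH2 H2 E)).HX
      ((ppm (k1 := k1) r1 H2 E * (ptMat (partner (k1 := k1) (r1 := r1) (r2 := r2) E))ᵀ) p)) c).trans ?_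
    rw [ppm_mul_transpose_apply, HGP_HX_mulVec_elim H1 (ancillaH2 H2 E)
      (Pi.single (Sum.inl p.1) 1) (fun b => edgeWord H2 p.2.1 b.1)
      (ancillaH2_mulVec_edgeWord hH2 hdisj p.2.2)]
    rfl
  logical_data := by
    ext p c
    refine (congrFun (Matrix.vecMul_transpose (HGP H1 H2).HX (ppm (k1 := k1) r1 H2 E p)) c).trans ?_
    rw [ppm_apply, HGP_HX_mulVec_elim H1 H2 (Pi.single (Sum.inl p.1) 1) (edgeWord H2 p.2.1)
      (mulVec_edgeWord hH2 _)]
    rfl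
  support := by
    ext p q
    exact congrFun (ppm_mul_transpose_mul p) q

theorem hasDistances (hH1 : IsUnit H1.toCols₂) (hH2 : IsUnit H2.toCols₂) {d1 d2 : ℕ}
    (hd1 : IsMinDist H1 d1) (hd2 : IsMinDist H2 d2)
    (hdisj : (E : Set (Finset (Fin k2))).PairwiseDisjoint id) :
    HasDistances (HGP H1 H2) (HGP H1 (ancillaH2 H2 E)) (min d1 d2) where
  ancilla_x := HGP_exists_vecMul_HX (ancillaH2_rows_indep hH2 hdisj)
    fun _ hv h0 => (min_le_left _ _).trans (hd1.le hv h0)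
  data_x := HGP_exists_vecMul_HX (rows_indep_of_isUnit hH2)
    fun _ hv h0 => (min_le_left _ _).trans (hd1.le hv h0)
  data_z := HGP_exists_vecMul_HZ (rows_indep_of_isUnit hH1)
    fun _ hv h0 => (min_le_right _ _).trans (hd2.le hv h0)

/-- Both check matrices have independent rows, so the count of logical qubits factors as the product
of the two classical dimensions, `k1` and `E.card`. -/
theorem rank_add_rank_ancilla (hH1 : IsUnit H1.toCols₂) (hH2 : IsUnit H2.toCols₂)
    (hdisj : (E : Set (Finset (Fin k2))).PairwiseDisjoint id) (hne : ∅ ∉ E) :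
    (HGP H1 (ancillaH2 H2 E)).HX.rank + (HGP H1 (ancillaH2 H2 E)).HZ.rank + k1 * E.card =
      Fintype.card (((Fin k1 ⊕ Fin r1) × {b : Fin k2 ⊕ Fin r2 // b ∉ puncturedBits r2 E}) ⊕
        (Fin r1 × (Fin r2 ⊕ RepCheck E))) := by
  rw [rank_of_rows_indep (HGP_rows_HX_indep (ancillaH2_rows_indep hH2 hdisj)),
    rank_of_rows_indep (HGP_rows_HZ_indep (rows_indep_of_isUnit hH1)), Fintype.card_prod,
    Fintype.card_prod, Fintype.card_sum (α := _ × _), Fintype.card_prod, Fintype.card_prod,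
    card_columns_ancillaH2 hdisj hne, Fintype.card_sum (α := Fin k1)]
  simp only [Fintype.card_fin]
  ring

theorem le_distance_ancilla (hH1 : IsUnit H1.toCols₂) (hH2 : IsUnit H2.toCols₂) {d1 d2 : ℕ}
    (hd1 : IsMinDist H1 d1) (hd2 : IsMinDist H2 d2)
    (hdisj : (E : Set (Finset (Fin k2))).PairwiseDisjoint id) :
    ((min d1 d2 : ℕ) : ℕ∞) ≤ (HGP H1 (ancillaH2 H2 E)).distance :=
  le_distance_of_hammingNorm _ _ (hasDistances hH1 hH2 hd1 hd2 hdisj).ancilla_x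
    (HGP_exists_vecMul_HZ (rows_indep_of_isUnit hH1)
      fun v hv h0 => (min_le_right _ _).trans (ancillaH2_hammingNorm_ge hd2 v hv h0))

end Gadget

end HGPGadget

end

theorem mainTheorem4 {k1 r1 k2 r2 : ℕ}
    (H1 : Matrix (Fin r1) (Fin k1 ⊕ Fin r1) (ZMod 2))
    (H2 : Matrix (Fin r2) (Fin k2 ⊕ Fin r2) (ZMod 2))
    (hH1 : IsUnit H1.toCols₂) (hH2 : IsUnit H2.toCols₂)
    (d1 d2 : ℕ) (hd1 : HGPGadget.IsMinDist H1 d1) (hd2 : HGPGadget.IsMinDist H2 d2)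
    (E : Finset (Finset (Fin k2)))
    (hdisj : (E : Set (Finset (Fin k2))).PairwiseDisjoint id) (hne : ∅ ∉ E) :
    -- the ancilla code encodes `k1 * |E|` logical qubits
    (HGPGadget.HGP H1 (HGPGadget.ancillaH2 H2 E)).HX.rank +
        (HGPGadget.HGP H1 (HGPGadget.ancillaH2 H2 E)).HZ.rank + k1 * E.card =
      Fintype.card (((Fin k1 ⊕ Fin r1) ×
          {b : Fin k2 ⊕ Fin r2 // b ∉ HGPGadget.puncturedBits r2 E}) ⊕
        (Fin r1 × (Fin r2 ⊕ HGPGadget.RepCheck E))) ∧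
    -- its distance is at least `min d1 d2`
    ((min d1 d2 : ℕ) : ℕ∞) ≤ (HGPGadget.HGP H1 (HGPGadget.ancillaH2 H2 E)).distance ∧
    -- the gadget measures the Pauli products in parallel
    HGPGadget.Performs (HGPGadget.HGP H1 H2) (HGPGadget.HGP H1 (HGPGadget.ancillaH2 H2 E))
      (HGPGadget.partner E) (min d1 d2) (HGPGadget.ppm (k1 := k1) r1 H2 E) ∧
    -- and fault-tolerantly
    HGPGadget.ToleratesFaults (HGPGadget.HGP H1 H2) (HGPGadget.HGP H1 (HGPGadget.ancillaH2 H2 E))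
      (HGPGadget.partner E) (min d1 d2) (HGPGadget.ppm (k1 := k1) r1 H2 E) (min d1 d2) := by
  -- At least one round is needed: without it the `X`-checks of the ancilla code are never
  -- projected.
  have hd : 0 < min d1 d2 := lt_min hd1.pos hd2.pos
  have h := HGPGadget.isSteaneGadget hH1 hH2 hdisj
  exact ⟨HGPGadget.rank_add_rank_ancilla hH1 hH2 hdisj hne,
    HGPGadget.le_distance_ancilla hH1 hH2 hd1 hd2 hdisj, h.performs hd,
    h.toleratesFaults hd (HGPGadget.hasDistances hH1 hH2 hd1 hd2 hdisj)⟩
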